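/- Let $T>0$, let $b,\mu\in L^\infty(0,T)$ be real-valued, and assume that there is $\mu_0>0$ with $\mu(s)\ge\mu_0$ for a.e. $s\in(0,T)$. Let $g_{in}\in L^2(\mathbb R_+)$ and $S\in L^1((0,T),L^2(\mathbb R_+))$, where $\mathbb R_+=(0,\infty)$ and $L^2$ consists of real-valued functions. Then the problem $$\partial_s g+b(s)\,\partial_Z g+\mu(s)\,\partial_Z^4 g=S(s,Z),\quad s\in(0,T),\ Z>0,\qquad g_{|s=0}=g_{in},\qquad g_{|Z=0}=0,\quad \partial_Z g_{|Z=0}=0,$$ has a unique solution $g\in C([0,T],L^2(\mathbb R_+))\cap L^2((0,T),H^2(\mathbb R_+))$, and for every $s\in[0,T]$ this solution satisfies the energy estimate $$\frac12\|g(s)\|_{L^2(\mathbb R_+)}^2+\int_0^s\mu(s')\,\|\partial_Z^2 g(s')\|_{L^2(\mathbb R_+)}^2\,ds'\ \le\ \|g_{in}\|_{L^2(\mathbb R_+)}^2+\Big(\int_0^s\|S(s')\|_{L^2(\mathbb R_+)}\,ds'\Big)^2 .$$ Here, with $V=\{v\in H^2(\mathbb R_+): v(0)=\partial_Z v(0)=0\}$,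 a solution is a function $g\in C([0,T],L^2(\mathbb R_+))\cap L^2((0,T),H^2(\mathbb R_+))$ with $g(0)=g_{in}$ and $g(s)\in V$ for a.e. $s\in(0,T)$ that satisfies the equation in the variational sense: for all $v\in V$ and all $s\in[0,T]$, $$\langle g(s),v\rangle-\langle g_{in},v\rangle+\int_0^s\Big(b(s')\langle\partial_Z g(s'),v\rangle+\mu(s')\langle\partial_Z^2 g(s'),\partial_Z^2 v\rangle\Big)ds'=\int_0^s\langle S(s'),v\rangle\,ds',$$ where $\langle\cdot,\cdot\rangle$ is the inner product of $L^2(\mathbb R_+)$. -/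

import Mathlib

open MeasureTheory Set
open scoped ContDiff

namespace BoundaryLayer

/-- The real Hilbert space `L²(ℝ₊)`, where `ℝ₊ = (0, ∞)` carries Lebesgue measure. -/
abbrev L2Pos : Type := Lp ℝ 2 (volume.restrict (Ioi (0 : ℝ)))

/-- `w` is the derivative of `u` in the sense of distributions on `(0, ∞)`:
`∫ u φ' = - ∫ w φ` for every smooth `φ` with compact support in `(0, ∞)`. -/
def IsWeakDeriv (u w : L2Pos) : Prop :=
  ∀ φ : ℝ → ℝ, ContDiff ℝ ∞ φ → HasCompactSupport φ → tsupport φ ⊆ Ioi 0 →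
    ∫ Z in Ioi (0 : ℝ), u Z * deriv φ Z = -∫ Z in Ioi (0 : ℝ), w Z * φ Z

/-- The weak derivative in `L²(ℝ₊)` is unique. -/
theorem IsWeakDeriv.unique {u w₁ w₂ : L2Pos} (h₁ : IsWeakDeriv u w₁) (h₂ : IsWeakDeriv u w₂) :
    w₁ = w₂ := by
  have hint : ∀ w : L2Pos, LocallyIntegrableOn (fun Z => w Z) (Ioi (0 : ℝ)) volume := by
    intro w
    exact locallyIntegrableOn_of_locallyIntegrable_restrict
      ((Lp.memLp w).locallyIntegrable (by norm_num))
  have hmul : ∀ (w : L2Pos) (φ : ℝ → ℝ), ContDiff ℝ ∞ φ → HasCompactSupport φ →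
      Integrable (fun Z => w Z * φ Z) (volume.restrict (Ioi (0 : ℝ))) := by
    intro w φ hφ hc
    have h2 : MemLp φ 2 (volume.restrict (Ioi (0 : ℝ))) :=
      hφ.continuous.memLp_of_hasCompactSupport hc
    exact MemLp.integrable_mul (Lp.memLp w) h2
  apply Lp.ext
  have key := isOpen_Ioi.ae_eq_zero_of_integral_contDiff_smul_eq_zero
    (U := Ioi (0 : ℝ)) (μ := volume) (f := fun Z => w₁ Z - w₂ Z)
    ((hint w₁).sub (hint w₂)) (by
      intro φ hφ hc hs
      have e1 := h₁ φ hφ hc hs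
      have e2 := h₂ φ hφ hc hs
      have e3 : ∫ Z in Ioi (0 : ℝ), φ Z • (w₁ Z - w₂ Z) = 0 := by
        have : ∀ Z, φ Z • (w₁ Z - w₂ Z) = w₁ Z * φ Z - w₂ Z * φ Z := by
          intro Z; simp only [smul_eq_mul]; ring
        simp only [this]
        rw [integral_sub (hmul w₁ φ hφ hc) (hmul w₂ φ hφ hc)]
        linarith
      refine (setIntegral_eq_integral_of_forall_compl_eq_zero ?_).symm.trans e3
      intro Z hZ
      have : φ Z = 0 := image_eq_zero_of_notMem_tsupport (fun h => hZ (hs h))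
      simp [this])
  rw [Filter.EventuallyEq, ae_restrict_iff' measurableSet_Ioi]
  filter_upwards [key] with Z hZ hZ'
  exact sub_eq_zero.mp (hZ hZ')

/-- `u` has a weak derivative that lies in `L²(ℝ₊)`, that is, `u ∈ H¹(ℝ₊)`. -/
def MemH1 (u : L2Pos) : Prop := ∃ w : L2Pos, IsWeakDeriv u w

open Classical in
/-- The weak derivative `∂_Z u ∈ L²(ℝ₊)` of `u ∈ H¹(ℝ₊)` (and `0` if `u ∉ H¹(ℝ₊)`). -/
noncomputable def weakDeriv (u : L2Pos) : L2Pos :=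
  if h : MemH1 u then h.choose else 0

theorem IsWeakDeriv.weakDeriv_eq {u w : L2Pos} (h : IsWeakDeriv u w) : weakDeriv u = w := by
  have hu : MemH1 u := ⟨w, h⟩
  rw [weakDeriv, dif_pos hu]
  exact hu.choose_spec.unique h

/-- `u ∈ H²(ℝ₊)`: both `u` and `∂_Z u` have a weak derivative in `L²(ℝ₊)`. -/
def MemH2 (u : L2Pos) : Prop := MemH1 u ∧ MemH1 (weakDeriv u)

/-- The trace of `u` at `Z = 0` exists and equals `a`: `u` agrees almost everywhere on `(0, ∞)`
with a function that is continuous on `[0, ∞)` and has the value `a` at `0`. -/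
def HasTrace (u : L2Pos) (a : ℝ) : Prop :=
  ∃ v : ℝ → ℝ, ContinuousOn v (Ici 0) ∧ (∀ᵐ Z ∂(volume.restrict (Ioi (0 : ℝ))), u Z = v Z) ∧
    v 0 = a

/-- `u ∈ V = {u ∈ H²(ℝ₊) : u = ∂_Z u = 0 at Z = 0}`. -/
def MemV (u : L2Pos) : Prop := MemH2 u ∧ HasTrace u 0 ∧ HasTrace (weakDeriv u) 0

/-- `g ∈ C([0,T], L²(ℝ₊)) ∩ L²((0,T), H²(ℝ₊))` is a (variational) solution of
`∂ₛ g + b(s) ∂_Z g + μ(s) ∂_Z⁴ g = S` on `(0,T) × ℝ₊`, `g = ∂_Z g = 0` at `Z = 0`, `g(0) = gin`.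
Only the values of `g` on `[0,T]` matter. -/
structure IsSolution (T : ℝ) (b μ : ℝ → ℝ) (gin : L2Pos) (S : ℝ → L2Pos) (g : ℝ → L2Pos) :
    Prop where
  continuousOn : ContinuousOn g (Icc 0 T)
  memH2 : ∀ᵐ s ∂(volume.restrict (Ioo 0 T)), MemH2 (g s)
  memLp : MemLp g 2 (volume.restrict (Ioo 0 T))
  memLp_deriv : MemLp (fun s => weakDeriv (g s)) 2 (volume.restrict (Ioo 0 T))
  memLp_deriv2 : MemLp (fun s => weakDeriv (weakDeriv (g s))) 2 (volume.restrict (Ioo 0 T))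
  boundary : ∀ᵐ s ∂(volume.restrict (Ioo 0 T)), HasTrace (g s) 0 ∧ HasTrace (weakDeriv (g s)) 0
  initial : g 0 = gin
  /-- The equation, tested against `v ∈ V` in `Z` and integrated in time. -/
  equation : ∀ v : L2Pos, MemV v → ∀ s ∈ Icc 0 T,
    inner ℝ (g s) v - inner ℝ (g 0) v
      + ∫ r in (0 : ℝ)..s, (b r * inner ℝ (weakDeriv (g r)) v
          + μ r * inner ℝ (weakDeriv (weakDeriv (g r))) (weakDeriv (weakDeriv v)))
      = ∫ r in (0 : ℝ)..s, inner ℝ (S r) v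

end BoundaryLayer

/-! The problem is a parabolic equation for the form `b ⟨∂u, v⟩ + μ ⟨∂²u, ∂²v⟩` on the Hilbert space
`V`, densely embedded in `H = L²(ℝ₊)` by an injective map `i`. Functions vanishing at `0` satisfy
`⟨∂v, v⟩ = 0`, so transport drops out of the energy, and `‖∂v‖² ≤ ‖v‖ ‖∂²v‖` makes the form coercive
up to a multiple of `‖v‖²`. By Riesz the dual of `V` is replaced by `V`: the functional `v ↦ ⟨g, i
v⟩` is the vector `i† g`, and the equation reads `(i† i u)' + A u = i† σ`.

Existence (`exists_weak_solution`): adding `ε u'` turns the equation into a Volterra equation with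
bounded operators (`exists_volterra`). Its solutions satisfy bounds uniform in `ε` and solve the
original equation up to an error `O(√ε)`. The approximate solutions with error at most `√ε C` form
decreasing convex sets, so elements of nearly minimal norm converge strongly
(`exists_tendsto_mem_of_antitone_convex`); no weak topology is needed.

Continuity in `H` and the energy identity (`exists_continuousOn_energy`): the equation is smoothed
with `(i† i + ε)⁻¹`, for which the identity is an instance of `quadratic_primitive`. Applied to
differences of two smoothings, the identity gives uniform convergence in `H`. Uniqueness is the
identity for the difference of two solutions, whose data vanish.

Estimate: the identity and the Gronwall inequality `le_add_integral_of_sq_le` give `‖g(s)‖ ≤ ‖gin‖ +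
∫ ‖S‖`. Reinserting this bounds the left side by `(‖gin‖ + ∫ ‖S‖)² / 2 ≤ ‖gin‖² + (∫ ‖S‖)²`. -/

/-! ### Products of vector-valued primitives, and a substitute for weak compactness. -/

/-- Fubini: the left side is the integral of `L (f r) (g q)` over the square `(0, s]²`, and the
diagonal cuts the square into two triangles. Integrability of `f` and `g` is enough; nothing is
differentiated. -/
theorem bilin_primitive {E E' F : Type*} [NormedAddCommGroup E] [NormedSpace ℝ E] [CompleteSpace E]
    [NormedAddCommGroup E'] [NormedSpace ℝ E'] [CompleteSpace E']
    [NormedAddCommGroup F] [NormedSpace ℝ F] [CompleteSpace F]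
    (L : E →L[ℝ] E' →L[ℝ] F) {f : ℝ → E} {g : ℝ → E'} {s : ℝ} (hs : 0 ≤ s)
    (hf : IntegrableOn f (Ioc 0 s)) (hg : IntegrableOn g (Ioc 0 s)) :
    L (∫ r in (0 : ℝ)..s, f r) (∫ r in (0 : ℝ)..s, g r)
      = (∫ r in (0 : ℝ)..s, L (f r) (∫ q in (0 : ℝ)..r, g q))
        + ∫ r in (0 : ℝ)..s, L (∫ q in (0 : ℝ)..r, f q) (g r) := by
  set ν : Measure ℝ := volume.restrict (Ioc 0 s) with hν
  have hint : Integrable (fun z : ℝ × ℝ => L (f z.1) (g z.2)) (ν.prod ν) :=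
    hf.op_fst_snd (by fun_prop) ⟨‖L‖, L.le_opNorm₂⟩ hg
  let D : Set (ℝ × ℝ) := {z | z.2 ≤ z.1}
  have hD : MeasurableSet D := measurableSet_le measurable_snd measurable_fst
  have h1 := integral_prod_bilin (μ := ν) (ν := ν) L hf hg
  rw [intervalIntegral.integral_of_le hs, intervalIntegral.integral_of_le hs,
    intervalIntegral.integral_of_le hs, intervalIntegral.integral_of_le hs, ← h1,
    ← integral_add_compl hD hint, ← integral_indicator hD, ← integral_indicator hD.compl,
    integral_prod _ (hint.indicator hD), integral_prod_symm _ (hint.indicator hD.compl)]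
  congr 1
  · refine setIntegral_congr_fun measurableSet_Ioc fun r hr => ?_
    have hsub : Ioc 0 r ⊆ Ioc 0 s := Ioc_subset_Ioc_right hr.2
    rw [intervalIntegral.integral_of_le hr.1.le,
      ← ContinuousLinearMap.integral_comp_comm _ (hg.mono_set hsub)]
    have : ∀ q, D.indicator (fun z : ℝ × ℝ => L (f z.1) (g z.2)) (r, q)
        = (Iic r).indicator (fun q => L (f r) (g q)) q := by
      intro q; simp [indicator, D]
    simp_rw [this]
    rw [integral_indicator measurableSet_Iic, hν, Measure.restrict_restrict measurableSet_Iic]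
    congr 2
    ext q; simp only [mem_inter_iff, mem_Iic, mem_Ioc]; constructor
    · rintro ⟨a, b, c⟩; exact ⟨b, a⟩
    · rintro ⟨a, b⟩; exact ⟨b, a, b.trans hr.2⟩
  · refine setIntegral_congr_fun measurableSet_Ioc fun r hr => ?_
    have hsub : Ioc 0 r ⊆ Ioc 0 s := Ioc_subset_Ioc_right hr.2
    rw [intervalIntegral.integral_of_le hr.1.le, ← L.flip_apply,
      ← ContinuousLinearMap.integral_comp_comm _ (hf.mono_set hsub)]
    have : ∀ q, Dᶜ.indicator (fun z : ℝ × ℝ => L (f z.1) (g z.2)) (q, r)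
        = (Iio r).indicator (fun q => L.flip (g r) (f q)) q := by
      intro q; simp [indicator, D]
    simp_rw [this]
    rw [integral_indicator measurableSet_Iio, hν, Measure.restrict_restrict measurableSet_Iio]
    refine (setIntegral_congr_set ?_)
    have : Iio r ∩ Ioc 0 s = Ioo 0 r := by
      ext q; simp only [mem_inter_iff, mem_Iio, mem_Ioc, mem_Ioo]; constructor
      · rintro ⟨a, b, c⟩; exact ⟨b, a⟩
      · rintro ⟨a, b⟩; exact ⟨b, a, b.le.trans hr.2⟩
    rw [this]; exact Ioo_ae_eq_Ioc

section

variable {E : Type*} [NormedAddCommGroup E] [InnerProductSpace ℝ E] [CompleteSpace E]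

/-- The chain rule `⟨G, B G⟩' = 2 ⟨G', B G⟩` in integrated form: by symmetry of `B` the two
triangles contribute equally. Every energy identity below comes from it. -/
theorem quadratic_primitive (B : E →L[ℝ] E) (hB : ∀ x y, inner ℝ (B x) y = inner ℝ x (B y))
    (x₀ : E) {F : ℝ → E} {s : ℝ} (hs : 0 ≤ s) (hF : IntegrableOn F (Ioc 0 s)) :
    inner ℝ (x₀ + ∫ r in (0 : ℝ)..s, F r) (B (x₀ + ∫ r in (0 : ℝ)..s, F r))
      = inner ℝ x₀ (B x₀)
        + 2 * ∫ r in (0 : ℝ)..s, inner ℝ (F r) (B (x₀ + ∫ q in (0 : ℝ)..r, F q)) := by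
  have hFi : IntervalIntegrable F volume 0 s := (intervalIntegrable_iff_integrableOn_Ioc_of_le hs).2 hF
  let L : E →L[ℝ] E →L[ℝ] ℝ := (ContinuousLinearMap.compL ℝ E E ℝ).flip B ∘L innerSL ℝ
  have hL : ∀ x y, L x y = inner ℝ x (B y) := fun x y => rfl
  have h1 := bilin_primitive L hs hF hF
  simp only [hL] at h1
  have hc : ContinuousOn (fun r => ∫ q in (0 : ℝ)..r, F q) (Icc 0 s) := by
    have := intervalIntegral.continuousOn_primitive_interval (μ := volume) (f := F) (a := 0) (b := s)
      (by rw [uIcc_of_le hs]; exact (integrableOn_Icc_iff_integrableOn_Ioc).2 hF)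
    rwa [uIcc_of_le hs] at this
  have hi1 : IntervalIntegrable (fun r => inner ℝ (F r) (B x₀)) volume 0 s :=
    (intervalIntegrable_iff_integrableOn_Ioc_of_le hs).2 (hF.inner_const _)
  have hi2 : IntervalIntegrable (fun r => inner ℝ (F r) (B (∫ q in (0 : ℝ)..r, F q))) volume 0 s := by
    rw [intervalIntegrable_iff_integrableOn_Ioc_of_le hs]
    obtain ⟨C, hC⟩ := isCompact_Icc.exists_bound_of_continuousOn
      (B.continuous.comp_continuousOn hc)
    refine Integrable.mono' (hF.norm.mul_const C) ?_ ?_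
    · exact hF.aestronglyMeasurable.inner
        (((B.continuous.comp_continuousOn hc).mono Ioc_subset_Icc_self).aestronglyMeasurable
          measurableSet_Ioc)
    · filter_upwards [ae_restrict_mem measurableSet_Ioc] with r hr
      refine (norm_inner_le_norm _ _).trans ?_
      gcongr
      exact hC r (Ioc_subset_Icc_self hr)
  have h2 : (∫ r in (0 : ℝ)..s, inner ℝ (∫ q in (0 : ℝ)..r, F q) (B (F r)))
      = ∫ r in (0 : ℝ)..s, inner ℝ (F r) (B (∫ q in (0 : ℝ)..r, F q)) := by
    congr 1; ext r; rw [← hB, real_inner_comm]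
  have h3 : (∫ r in (0 : ℝ)..s, inner ℝ (F r) (B x₀))
      = inner ℝ (∫ r in (0 : ℝ)..s, F r) (B x₀) := by
    have := ((innerSL ℝ (B x₀)).intervalIntegral_comp_comm hFi)
    simp only [innerSL_apply_apply] at this
    rw [real_inner_comm, ← this]; congr 1; ext r; rw [real_inner_comm]
  have h4 : inner ℝ x₀ (B (∫ r in (0 : ℝ)..s, F r)) = inner ℝ (∫ r in (0 : ℝ)..s, F r) (B x₀) := by
    rw [← hB, real_inner_comm]
  simp only [map_add, inner_add_right, inner_add_left]
  rw [intervalIntegral.integral_add hi1 hi2, h3, h4, h1, h2]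
  ring

/-- Nearly minimal elements of a decreasing sequence of convex sets, each of which meets a fixed
ball, form a convergent sequence. -/
theorem exists_tendsto_mem_of_antitone_convex (Z : ℕ → Set E) (hanti : Antitone Z)
    (hconv : ∀ n, Convex ℝ (Z n)) (M : ℝ) (hne : ∀ n, ∃ w ∈ Z n, ‖w‖ ≤ M) :
    ∃ (w : ℕ → E) (u : E), (∀ n, w n ∈ Z n) ∧ Filter.Tendsto w Filter.atTop (nhds u) := by
  let d : ℕ → ℝ := fun n => sInf ((fun w => ‖w‖ ^ 2) '' Z n)
  have hbdd : ∀ n, BddBelow ((fun w => ‖w‖ ^ 2) '' Z n) := fun n =>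
    ⟨0, by rintro _ ⟨w, -, rfl⟩; positivity⟩
  have hd : ∀ n, ∀ w ∈ Z n, d n ≤ ‖w‖ ^ 2 := fun n w hw => csInf_le (hbdd n) ⟨w, hw, rfl⟩
  have hne' : ∀ n, ((fun w => ‖w‖ ^ 2) '' Z n).Nonempty := fun n => by
    obtain ⟨w, hw, -⟩ := hne n; exact ⟨_, w, hw, rfl⟩
  have hmono : Monotone d := fun n m h => csInf_le_csInf (hbdd n) (hne' m) (image_mono (hanti h))
  have hle : ∀ n, d n ≤ M ^ 2 := fun n => by
    obtain ⟨w, hw, h⟩ := hne n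
    exact (hd n w hw).trans (by gcongr)
  have hch : ∀ n : ℕ, ∃ w ∈ Z n, ‖w‖ ^ 2 < d n + 1 / ((n : ℝ) + 1) := fun n => by
    obtain ⟨_, ⟨w, hw, rfl⟩, h⟩ := exists_lt_of_csInf_lt (hne' n)
      (lt_add_of_pos_right (d n) (by positivity : (0 : ℝ) < 1 / ((n : ℝ) + 1)))
    exact ⟨w, hw, h⟩
  choose w hw hwd using hch
  have hlim := tendsto_atTop_ciSup hmono ⟨M ^ 2, by rintro _ ⟨n, rfl⟩; exact hle n⟩
  set D := ⨆ n, d n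
  have hdD : ∀ n, d n ≤ D := fun n => le_ciSup ⟨M ^ 2, by rintro _ ⟨n, rfl⟩; exact hle n⟩ n
  -- The midpoint of `w n` and `w m` lies in the larger set `Z n`, so its squared norm is at least
  -- `d n`; the parallelogram law then bounds the difference.
  have hkey : ∀ n m, n ≤ m → ‖w n - w m‖ ^ 2 ≤ 2 * (D - d n) + 4 * (1 / ((n : ℝ) + 1)) := by
    intro n m hnm
    have hmid : (1 / 2 : ℝ) • w n + (1 / 2 : ℝ) • w m ∈ Z n :=
      hconv n (hw n) (hanti hnm (hw m)) (by norm_num) (by norm_num) (by norm_num)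
    have h1 := hd n _ hmid
    have h2 := parallelogram_law_with_norm ℝ (w n) (w m)
    have h3 : ‖(1 / 2 : ℝ) • w n + (1 / 2 : ℝ) • w m‖ ^ 2 = 1 / 4 * ‖w n + w m‖ ^ 2 := by
      rw [← smul_add, norm_smul, mul_pow]; norm_num
    have h4 := hwd n
    have h5 := hwd m
    have h6 : 1 / ((m : ℝ) + 1) ≤ 1 / ((n : ℝ) + 1) := by gcongr
    have h7 := hdD m
    nlinarith
  have hlim2 : Filter.Tendsto (fun n : ℕ => √(2 * (D - d n) + 4 * (1 / ((n : ℝ) + 1))))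
      Filter.atTop (nhds 0) := by
    have h1 := ((hlim.const_sub D).const_mul 2).add
      (tendsto_one_div_add_atTop_nhds_zero_nat (𝕜 := ℝ) |>.const_mul 4)
    have h2 := (Real.continuous_sqrt.tendsto _).comp h1
    simpa [Function.comp_def] using h2
  have hc : CauchySeq w := cauchySeq_of_le_tendsto_0' _ (fun n m hnm => by
    rw [dist_eq_norm]; exact Real.le_sqrt_of_sq_le (hkey n m hnm)) hlim2
  obtain ⟨u, hu⟩ := cauchySeq_tendsto_of_complete hc
  exact ⟨w, u, hw, hu⟩

end

/-! ### Linear Volterra equations in a Banach space. -/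

/-- Linear Volterra equations with bounded measurable coefficients have continuous solutions. -/
theorem exists_volterra {E : Type*} [NormedAddCommGroup E] [NormedSpace ℝ E] [CompleteSpace E]
    {T : ℝ} (hT : 0 ≤ T) {A : ℝ → E →L[ℝ] E}
    (hA : AEStronglyMeasurable A (volume.restrict (Ioc 0 T))) {M : ℝ} (hM0 : 0 ≤ M)
    (hM : ∀ᵐ r ∂(volume.restrict (Ioc 0 T)), ‖A r‖ ≤ M) {f : ℝ → E}
    (hf : ContinuousOn f (Icc 0 T)) :
    ∃ u : ℝ → E, Continuous u ∧ ∀ s ∈ Icc 0 T, u s = f s + ∫ r in (0 : ℝ)..s, A r (u r) := by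
  have hAi : ∀ v : ℝ → E, Continuous v → IntegrableOn (fun r => A r (v r)) (Ioc 0 T) := by
    intro v hv
    obtain ⟨C, hC⟩ := isCompact_Icc.exists_bound_of_continuousOn (hv.continuousOn (s := Icc 0 T))
    refine Integrable.mono' (integrable_const (M * C)) 
      ((ContinuousLinearMap.id ℝ (E →L[ℝ] E)).aestronglyMeasurable_comp₂ hA hv.aestronglyMeasurable) ?_
    filter_upwards [hM, ae_restrict_mem measurableSet_Ioc] with r hr hrT
    exact (ContinuousLinearMap.le_opNorm _ _).trans
      (mul_le_mul hr (hC r (Ioc_subset_Icc_self hrT)) (norm_nonneg _) hM0)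
  let ext : C(Icc 0 T, E) → ℝ → E := fun u => IccExtend hT u
  have hext : ∀ u, Continuous (ext u) := fun u => u.continuous.Icc_extend'
  have hcont : ∀ u, Continuous fun s : Icc 0 T =>
      f s + ∫ r in (0 : ℝ)..(s : ℝ), A r (ext u r) := by
    intro u
    have h := intervalIntegral.continuousOn_primitive_interval (μ := volume)
      (f := fun r => A r (ext u r)) (a := 0) (b := T)
      (by rw [uIcc_of_le hT]; exact (integrableOn_Icc_iff_integrableOn_Ioc).2 (hAi _ (hext u)))
    rw [uIcc_of_le hT] at h
    exact continuousOn_iff_continuous_domRestrict.1 (hf.add h)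
  let Φ : C(Icc 0 T, E) → C(Icc 0 T, E) := fun u => ⟨_, hcont u⟩
  have hΦ : ∀ u s, Φ u s = f s + ∫ r in (0 : ℝ)..(s : ℝ), A r (ext u r) := fun _ _ => rfl
  -- Each iteration integrates the previous bound once more, which produces the factorial; hence
  -- some iterate of `Φ` is a contraction, and its fixed point is also fixed by `Φ`.
  have key : ∀ n u w (s : Icc 0 T),
      ‖Φ^[n] u s - Φ^[n] w s‖ ≤ (M * s) ^ n / n.factorial * dist u w := by
    intro n
    induction n with
    | zero =>
      intro u w s
      simpa [dist_eq_norm] using (u - w).norm_coe_le_norm s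
    | succ n ih =>
      intro u w s
      simp only [Function.iterate_succ_apply']
      set a := Φ^[n] u
      set c := Φ^[n] w
      have hsT : Ioc (0 : ℝ) s ⊆ Ioc 0 T := Ioc_subset_Ioc_right s.2.2
      have hi : ∀ v, IntervalIntegrable (fun r => A r (ext v r)) volume 0 s := fun v =>
        (intervalIntegrable_iff_integrableOn_Ioc_of_le s.2.1).2 ((hAi _ (hext v)).mono_set hsT)
      have e1 : Φ a s - Φ c s = ∫ r in (0 : ℝ)..s, A r (ext a r - ext c r) := by
        rw [hΦ, hΦ, add_sub_add_left_eq_sub, ← intervalIntegral.integral_sub (hi a) (hi c)]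
        simp
      rw [e1]
      have e2 : ∫ r in (0 : ℝ)..s, M * ((M * r) ^ n / n.factorial * dist u w)
          = (M * s) ^ (n + 1) / (n + 1).factorial * dist u w := by
        have : ∀ r : ℝ, M * ((M * r) ^ n / n.factorial * dist u w)
            = M ^ (n + 1) / n.factorial * dist u w * r ^ n := by intro r; rw [mul_pow]; ring
        simp_rw [this]
        rw [intervalIntegral.integral_const_mul, integral_pow, Nat.factorial_succ]
        push_cast
        have := Nat.factorial_ne_zero n
        rw [mul_pow]
        field_simp
        simp
      rw [← e2]
      refine intervalIntegral.norm_integral_le_of_norm_le s.2.1 ?_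
        (Continuous.intervalIntegrable (by fun_prop) _ _)
      have hM' := ae_restrict_of_ae_restrict_of_subset hsT hM
      rw [ae_restrict_iff' measurableSet_Ioc] at hM'
      filter_upwards [hM'] with r hr hrs
      have hrT : r ∈ Icc 0 T := Ioc_subset_Icc_self (hsT hrs)
      refine (ContinuousLinearMap.le_opNorm _ _).trans (mul_le_mul (hr hrs) ?_ (norm_nonneg _) hM0)
      have := ih u w ⟨r, hrT⟩
      simpa [ext, IccExtend_of_mem hT _ hrT] using this
  have hdist : ∀ n u w, dist (Φ^[n] u) (Φ^[n] w) ≤ (M * T) ^ n / n.factorial * dist u w := by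
    intro n u w
    rw [ContinuousMap.dist_le (by positivity)]
    intro s
    rw [dist_eq_norm]
    refine (key n u w s).trans ?_
    have h0 := s.2.1
    have h1 := s.2.2
    gcongr
  obtain ⟨n, hn⟩ := ((FloorSemiring.tendsto_pow_div_factorial_atTop (M * T)).eventually
    (gt_mem_nhds (zero_lt_one' ℝ))).exists
  have hcontr : ContractingWith ((M * T) ^ n / n.factorial).toNNReal Φ^[n] := by
    refine ⟨Real.toNNReal_lt_one.2 hn, LipschitzWith.of_dist_le_mul fun u w => ?_⟩
    rw [Real.coe_toNNReal _ (by positivity)]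
    exact hdist n u w
  have hfix := hcontr.isFixedPt_fixedPoint_iterate
  refine ⟨ext (hcontr.fixedPoint), hext _, fun s hs => ?_⟩
  have h := congrArg (fun v : C(Icc 0 T, E) => v ⟨s, hs⟩) hfix.eq
  simp only [hΦ] at h
  rw [h]
  simp [ext, IccExtend_of_mem hT _ hs]

/-! ### Resolvents of positive operators. -/

section

variable {E : Type*} [NormedAddCommGroup E] [InnerProductSpace ℝ E] [CompleteSpace E]

/-- The inverse of `K + ε`. -/
noncomputable def regInv (K : E →L[ℝ] E) (ε : ℝ) : E →L[ℝ] E := Ring.inverse (K + ε • 1)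

theorem isUnit_add_smul_one {K : E →L[ℝ] E} (hK : K.IsPositive) {ε : ℝ} (hε : 0 < ε) :
    IsUnit (K + ε • (1 : E →L[ℝ] E)) := by
  refine ContinuousLinearMap.isUnit_of_forall_le_norm_inner_map _ (c := ⟨ε, hε.le⟩) hε fun x => ?_
  have h1 : 0 ≤ inner ℝ (K x) x := by simpa using hK.inner_nonneg_left x
  have h2 : inner ℝ ((K + ε • (1 : E →L[ℝ] E)) x) x = inner ℝ (K x) x + ε * ‖x‖ ^ 2 := by
    simp [inner_add_left, inner_smul_left]
  rw [h2, Real.norm_eq_abs, abs_of_nonneg (by positivity)]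
  change ‖x‖ ^ 2 * ε ≤ _
  linarith

theorem regInv_right {K : E →L[ℝ] E} (hK : K.IsPositive) {ε : ℝ} (hε : 0 < ε) (x : E) :
    K (regInv K ε x) + ε • regInv K ε x = x := by
  have := congrArg (fun f : E →L[ℝ] E => f x) (Ring.mul_inverse_cancel _ (isUnit_add_smul_one hK hε))
  simpa [regInv] using this

theorem regInv_left {K : E →L[ℝ] E} (hK : K.IsPositive) {ε : ℝ} (hε : 0 < ε) (x : E) :
    regInv K ε (K x) + ε • regInv K ε x = x := by
  have := congrArg (fun f : E →L[ℝ] E => f x) (Ring.inverse_mul_cancel _ (isUnit_add_smul_one hK hε))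
  simpa [regInv] using this

theorem regInv_comm {K : E →L[ℝ] E} (hK : K.IsPositive) {ε : ℝ} (hε : 0 < ε) (x : E) :
    regInv K ε (K x) = K (regInv K ε x) := by
  have h1 := regInv_right hK hε x
  have h2 := regInv_left hK hε x
  exact add_right_cancel (h2.trans h1.symm)

theorem inner_regInv {K : E →L[ℝ] E} (hK : K.IsPositive) {ε : ℝ} (hε : 0 < ε) (x y : E) :
    inner ℝ (regInv K ε x) y = inner ℝ x (regInv K ε y) := by
  conv_lhs => rw [← regInv_right hK hε y]
  conv_rhs => rw [← regInv_right hK hε x]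
  have : ∀ a b, inner ℝ (K a) b = inner ℝ a (K b) := hK.isSymmetric
  simp only [inner_add_left, inner_add_right, inner_smul_left, inner_smul_right, this]
  rfl

/-- With `x = K y + ε y`, positivity makes the cross term in `‖x‖²` nonnegative, so `‖K y‖ ≤ ‖x‖`.
-/
theorem norm_regInv_comp_le {K : E →L[ℝ] E} (hK : K.IsPositive) {ε : ℝ} (hε : 0 < ε) (x : E) :
    ‖regInv K ε (K x)‖ ≤ ‖x‖ := by
  rw [regInv_comm hK hε]
  set y := regInv K ε x with hy
  have h1 : 0 ≤ inner ℝ (K y) y := by simpa using hK.inner_nonneg_left y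
  have h2 : ‖x‖ ^ 2 = ‖K y‖ ^ 2 + 2 * (ε * inner ℝ (K y) y) + ‖ε • y‖ ^ 2 := by
    conv_lhs => rw [← regInv_right hK hε x, norm_add_sq_real, inner_smul_right]
  refine le_of_sq_le_sq ?_ (norm_nonneg _)
  nlinarith [mul_nonneg hε.le h1, sq_nonneg ‖ε • y‖]

/-- If `K ≥ 0` is injective, then `(K + ε)⁻¹ K → 1` strongly as `ε → 0`. -/
theorem tendsto_regInv_comp {K : E →L[ℝ] E} (hK : K.IsPositive) (hinj : Function.Injective K)
    (x : E) : Filter.Tendsto (fun n : ℕ => regInv K (1 / ((n : ℝ) + 1)) (K x)) Filter.atTop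
      (nhds x) := by
  have hsymm : ∀ a b, inner ℝ (K a) b = inner ℝ a (K b) := hK.isSymmetric
  have hpos : ∀ n : ℕ, (0 : ℝ) < 1 / ((n : ℝ) + 1) := fun n => by positivity
  -- A symmetric injective operator has dense range. On the range, `(K + ε)⁻¹ K (K y) = K y - ε (K +
  -- ε)⁻¹ K y` differs from `K y` by at most `ε ‖y‖`; the uniform bound extends convergence to the
  -- closure.
  have hdense : K.range.topologicalClosure = ⊤ := by
    rw [Submodule.topologicalClosure_eq_top_iff, Submodule.eq_bot_iff]
    intro y hy
    refine hinj ?_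
    rw [map_zero, ← inner_self_eq_zero (𝕜 := ℝ), ← hsymm]
    exact hy _ ⟨K y, rfl⟩
  rw [Metric.tendsto_atTop]
  intro δ hδ
  have hx : x ∈ closure (K.range : Set E) := by
    rw [← Submodule.topologicalClosure_coe, hdense]; trivial
  obtain ⟨_, ⟨y, rfl⟩, hy⟩ := Metric.mem_closure_iff.1 hx (δ / 3) (by positivity)
  have hlim := (tendsto_one_div_add_atTop_nhds_zero_nat (𝕜 := ℝ)).mul_const ‖y‖
  rw [zero_mul] at hlim
  obtain ⟨N, hN⟩ := Filter.eventually_atTop.1 (hlim.eventually (gt_mem_nhds (by positivity : 0 < δ / 3)))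
  refine ⟨N, fun n hn => ?_⟩
  have h1 : regInv K (1 / ((n : ℝ) + 1)) (K x) - x
      = regInv K (1 / ((n : ℝ) + 1)) (K (x - K y))
        - (1 / ((n : ℝ) + 1)) • regInv K (1 / ((n : ℝ) + 1)) (K y) - (x - K y) := by
    have := regInv_left hK (hpos n) (K y)
    rw [← eq_sub_iff_add_eq'] at this
    rw [this]; simp only [map_sub]; abel
  have h2 := norm_regInv_comp_le hK (hpos n) (x - K y)
  have h3 := norm_regInv_comp_le hK (hpos n) y
  rw [dist_eq_norm] at hy ⊢
  rw [h1]
  refine ((norm_sub_le _ _).trans (add_le_add_left (norm_sub_le _ _) _)).trans_lt ?_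
  rw [norm_smul, Real.norm_of_nonneg (hpos n).le]
  have := mul_le_mul_of_nonneg_left h3 (hpos n).le
  have := hN n hn
  change ‖x - K y‖ < _ at hy
  linarith

end

/-! ### Continuity in `H` and the energy identity. -/

section

open Filter Topology ContinuousLinearMap

variable {V H : Type*} [NormedAddCommGroup V] [InnerProductSpace ℝ V] [CompleteSpace V]
  [NormedAddCommGroup H] [InnerProductSpace ℝ H] [CompleteSpace H]

/-- Follows from `i (i† i + ε) = (i i† + ε) i`. It moves the smoothing from `V` to `H`, where `(i i†
+ ε)⁻¹ i i†` is again a contraction. -/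
theorem comp_regInv (i : V →L[ℝ] H) {ε : ℝ} (hε : 0 < ε) (x : V) :
    i (regInv (adjoint i ∘L i) ε x) = regInv (i ∘L adjoint i) ε (i x) := by
  have hK : (adjoint i ∘L i).IsPositive := isPositive_adjoint_comp_self i
  have hL : (i ∘L adjoint i).IsPositive := isPositive_self_comp_adjoint i
  conv_rhs => rw [← regInv_right hK hε x]
  have := regInv_left hL hε (i (regInv (adjoint i ∘L i) ε x))
  rw [map_add, map_smul, map_add, map_smul]
  exact this.symm

theorem continuousOn_primitive_Icc {E : Type*} [NormedAddCommGroup E] [NormedSpace ℝ E]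
    {T : ℝ} (hT : 0 ≤ T) {F : ℝ → E}
    (hF : IntegrableOn F (Ioc 0 T)) : ContinuousOn (fun s => ∫ r in (0 : ℝ)..s, F r) (Icc 0 T) := by
  have := intervalIntegral.continuousOn_primitive_interval (μ := volume) (f := F) (a := 0) (b := T)
    (by rw [uIcc_of_le hT]; exact (integrableOn_Icc_iff_integrableOn_Ioc).2 hF)
  rwa [uIcc_of_le hT] at this

theorem integrable_inner_of_memLp_two {E α : Type*} [NormedAddCommGroup E] [InnerProductSpace ℝ E]
    [MeasurableSpace α] {ν : Measure α} {f u : α → E}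
    (hf : MemLp f 2 ν) (hu : MemLp u 2 ν) : Integrable (fun r => inner ℝ (f r) (u r)) ν :=
  memLp_one_iff_integrable.1 (hu.of_bilin (r := 1) (fun a b => inner ℝ b a) 1 hf
    (hf.1.inner hu.1) (by
      filter_upwards with x
      simpa [mul_comm] using nnnorm_inner_le_nnnorm (𝕜 := ℝ) (f x) (u x)))

theorem integrable_norm_mul_norm {E α : Type*} [NormedAddCommGroup E] [MeasurableSpace α]
    {ν : Measure α} {f u : α → E}
    (hf : MemLp f 2 ν) (hu : MemLp u 2 ν) : Integrable (fun r => ‖f r‖ * ‖u r‖) ν :=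
  MemLp.integrable_mul hf.norm hu.norm

/-- Energy identity for a regularization of `g`, where `i† g = i† g₀ + ∫ (i† σ + f)`. -/
theorem norm_sq_regularization (i : V →L[ℝ] H) {T : ℝ} (g₀ : H) {σ : ℝ → H}
    (hσ : IntegrableOn σ (Ioc 0 T)) {f u : ℝ → V}
    (hf : IntegrableOn f (Ioc 0 T))
    (hG : ∀ᵐ s ∂(volume.restrict (Ioc 0 T)), adjoint i (i (u s))
      = adjoint i g₀ + ∫ r in (0 : ℝ)..s, (adjoint i (σ r) + f r))
    (J : V →L[ℝ] V) (R : H →L[ℝ] H) (hJ : ∀ x y, inner ℝ (J x) y = inner ℝ x (J y))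
    (hR : ∀ x, i (J x) = R (i x)) {s : ℝ} (hs : s ∈ Icc 0 T) :
    ‖i (J (adjoint i g₀ + ∫ r in (0 : ℝ)..s, (adjoint i (σ r) + f r)))‖ ^ 2
      = ‖R (i (adjoint i g₀))‖ ^ 2
        + 2 * ∫ r in (0 : ℝ)..s, (inner ℝ (σ r) (R (i (adjoint i (R (i (adjoint i (i (u r))))))))
          + inner ℝ (f r) (J (adjoint i (i (J (adjoint i (i (u r)))))))) := by
  have hF : IntegrableOn (fun r => adjoint i (σ r) + f r) (Ioc 0 T) :=
    ((adjoint i).integrable_comp hσ).add hf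
  have hsub : Ioc 0 s ⊆ Ioc 0 T := Ioc_subset_Ioc_right hs.2
  -- The quadratic form of `B` is `‖i J x‖²`. Only symmetry of `J` and `i J = R i` are used, so
  -- differences of resolvents are admissible too.
  let B : V →L[ℝ] V := J ∘L adjoint i ∘L i ∘L J
  have hB : ∀ x y, inner ℝ x (B y) = inner ℝ (i (J x)) (i (J y)) := by
    intro x y
    simp only [B, comp_apply]
    rw [← hJ, adjoint_inner_right]
  have hBs : ∀ x y, inner ℝ (B x) y = inner ℝ x (B y) := by
    intro x y
    rw [real_inner_comm, hB, hB, real_inner_comm]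
  have h1 := quadratic_primitive B hBs (adjoint i g₀) hs.1 (hF.mono_set hsub)
  rw [hB, hB, real_inner_self_eq_norm_sq, real_inner_self_eq_norm_sq, hR (adjoint i g₀)] at h1
  rw [h1]
  congr 2
  refine intervalIntegral.integral_congr_ae ?_
  rw [uIoc_of_le hs.1]
  have := ae_restrict_of_ae_restrict_of_subset hsub hG
  rw [ae_restrict_iff' measurableSet_Ioc] at this
  filter_upwards [this] with r hr hrs
  rw [← hr hrs, inner_add_left, adjoint_inner_left]
  simp only [B, comp_apply, hR]

theorem tendsto_iterate_twice {E : Type*} [NormedAddCommGroup E] [NormedSpace ℝ E]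
    (A : ℕ → E →L[ℝ] E) (hA : ∀ n y, ‖A n y‖ ≤ ‖y‖) {x : E}
    (hx : Tendsto (fun n => A n x) atTop (𝓝 x)) :
    Tendsto (fun n => A n (A n x)) atTop (𝓝 x) := by
  have : Tendsto (fun n => A n (A n x) - A n x) atTop (𝓝 0) := by
    refine squeeze_zero_norm (a := fun n => ‖A n x - x‖)
      (fun n => by rw [← map_sub]; exact hA _ _) ?_
    simpa using (hx.sub_const x).norm
  simpa using this.add hx

/-- If `i† i u = i† g₀ + ∫ (i† σ + f)` almost everywhere, then the right side equals `i† g` for a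
continuous function `g`, and `‖g‖²` satisfies the energy identity. -/
theorem exists_continuousOn_energy (i : V →L[ℝ] H) (hi : Function.Injective i)
    (hi' : Function.Injective (adjoint i)) {T : ℝ} (hT : 0 ≤ T) (g₀ : H) {σ : ℝ → H}
    (hσ : IntegrableOn σ (Ioc 0 T)) {f u : ℝ → V}
    (hf : MemLp f 2 (volume.restrict (Ioc 0 T))) (hu : MemLp u 2 (volume.restrict (Ioc 0 T)))
    {C : ℝ} (hC : ∀ᵐ r ∂(volume.restrict (Ioc 0 T)), ‖i (u r)‖ ≤ C)
    (hG : ∀ᵐ s ∂(volume.restrict (Ioc 0 T)), adjoint i (i (u s))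
      = adjoint i g₀ + ∫ r in (0 : ℝ)..s, (adjoint i (σ r) + f r)) :
    ∃ g : ℝ → H, ContinuousOn g (Icc 0 T) ∧
      (∀ s ∈ Icc 0 T, adjoint i (g s)
        = adjoint i g₀ + ∫ r in (0 : ℝ)..s, (adjoint i (σ r) + f r)) ∧
      ∀ s ∈ Icc 0 T, ‖g s‖ ^ 2 = ‖g₀‖ ^ 2
        + 2 * ∫ r in (0 : ℝ)..s, (inner ℝ (σ r) (i (u r)) + inner ℝ (f r) (u r)) := by
  have hf1 : IntegrableOn f (Ioc 0 T) := hf.integrable (by norm_num)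
  have hF : IntegrableOn (fun r => adjoint i (σ r) + f r) (Ioc 0 T) :=
    ((adjoint i).integrable_comp hσ).add hf1
  set G : ℝ → V := fun s => adjoint i g₀ + ∫ r in (0 : ℝ)..s, (adjoint i (σ r) + f r) with hGdef
  have hGc : ContinuousOn G (Icc 0 T) := continuousOn_const.add (continuousOn_primitive_Icc hT hF)
  have hK : (adjoint i ∘L i).IsPositive := isPositive_adjoint_comp_self i
  have hL : (i ∘L adjoint i).IsPositive := isPositive_self_comp_adjoint i
  have hKinj : Function.Injective (adjoint i ∘L i) := hi'.comp hi
  have hLinj : Function.Injective (i ∘L adjoint i) := hi.comp hi'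
  have hε : ∀ n : ℕ, (0 : ℝ) < 1 / ((n : ℝ) + 1) := fun n => by positivity
  let J : ℕ → V →L[ℝ] V := fun n => regInv (adjoint i ∘L i) (1 / ((n : ℝ) + 1))
  let R : ℕ → H →L[ℝ] H := fun n => regInv (i ∘L adjoint i) (1 / ((n : ℝ) + 1))
  have hJs : ∀ n x y, inner ℝ (J n x) y = inner ℝ x (J n y) := fun n => inner_regInv hK (hε n)
  have hJR : ∀ n x, i (J n x) = R n (i x) := fun n x => comp_regInv i (hε n) x
  have hPle : ∀ n x, ‖J n (adjoint i (i x))‖ ≤ ‖x‖ := fun n => norm_regInv_comp_le hK (hε n)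
  have hQle : ∀ n x, ‖R n (i (adjoint i x))‖ ≤ ‖x‖ := fun n => norm_regInv_comp_le hL (hε n)
  have hP : ∀ x, Tendsto (fun n => J n (adjoint i (i x))) atTop (𝓝 x) := tendsto_regInv_comp hK hKinj
  have hQ : ∀ x, Tendsto (fun n => R n (i (adjoint i x))) atTop (𝓝 x) := tendsto_regInv_comp hL hLinj
  -- The smoothing enters twice, and a difference of two contractions has norm at most `2`, hence
  -- the factor `4`. As `σ` is only `L¹` in time, its pairing needs the pointwise bound `C` on `i
  -- u`.
  have hbound : Integrable (fun r => 4 * (‖σ r‖ * C + ‖f r‖ * ‖u r‖)) (volume.restrict (Ioc 0 T)) :=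
    ((hσ.norm.mul_const C).add (integrable_norm_mul_norm hf hu)).const_mul 4
  have hmeas : ∀ (J : V →L[ℝ] V) (R : H →L[ℝ] H), AEStronglyMeasurable (fun r =>
      inner ℝ (σ r) (R (i (u r))) + inner ℝ (f r) (J (u r))) (volume.restrict (Ioc 0 T)) :=
    fun J R => (hσ.1.inner ((R ∘L i).continuous.comp_aestronglyMeasurable hu.1)).add
      (hf.1.inner (J.continuous.comp_aestronglyMeasurable hu.1))
  have hbd : ∀ (J : V →L[ℝ] V) (R : H →L[ℝ] H), (∀ x, ‖J x‖ ≤ 4 * ‖x‖) → (∀ x, ‖R x‖ ≤ 4 * ‖x‖) →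
      ∀ᵐ r ∂(volume.restrict (Ioc 0 T)),
        ‖inner ℝ (σ r) (R (i (u r))) + inner ℝ (f r) (J (u r))‖
          ≤ 4 * (‖σ r‖ * C + ‖f r‖ * ‖u r‖) := by
    intro J R hJ hR
    filter_upwards [hC] with r hr
    have h1 := norm_inner_le_norm (𝕜 := ℝ) (σ r) (R (i (u r)))
    have h2 := norm_inner_le_norm (𝕜 := ℝ) (f r) (J (u r))
    have h3 := mul_le_mul_of_nonneg_left ((hR (i (u r))).trans
      (mul_le_mul_of_nonneg_left hr (by norm_num))) (norm_nonneg (σ r))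
    have h4 := mul_le_mul_of_nonneg_left (hJ (u r)) (norm_nonneg (f r))
    refine (norm_add_le _ _).trans ?_
    linarith
  -- differences of two regularizations
  let dJ : ℕ × ℕ → V →L[ℝ] V := fun p => J p.1 - J p.2
  let dR : ℕ × ℕ → H →L[ℝ] H := fun p => R p.1 - R p.2
  have hdPle : ∀ p x, ‖dJ p (adjoint i (i x))‖ ≤ 2 * ‖x‖ := fun p x => by
    have := norm_sub_le (J p.1 (adjoint i (i x))) (J p.2 (adjoint i (i x)))
    have h1 := hPle p.1 x
    have h2 := hPle p.2 x
    simp only [dJ, sub_apply]; linarith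
  have hdQle : ∀ p x, ‖dR p (i (adjoint i x))‖ ≤ 2 * ‖x‖ := fun p x => by
    have := norm_sub_le (R p.1 (i (adjoint i x))) (R p.2 (i (adjoint i x)))
    have h1 := hQle p.1 x
    have h2 := hQle p.2 x
    simp only [dR, sub_apply]; linarith
  have hdP4 : ∀ p x, ‖dJ p (adjoint i (i (dJ p (adjoint i (i x)))))‖ ≤ 4 * ‖x‖ := fun p x => by
    linarith [hdPle p (dJ p (adjoint i (i x))), hdPle p x]
  have hdQ4 : ∀ p x, ‖dR p (i (adjoint i (dR p (i (adjoint i x)))))‖ ≤ 4 * ‖x‖ := fun p x => by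
    linarith [hdQle p (dR p (i (adjoint i x))), hdQle p x]
  have hP4 : ∀ n x, ‖J n (adjoint i (i (J n (adjoint i (i x)))))‖ ≤ 4 * ‖x‖ := fun n x => by
    linarith [hPle n (J n (adjoint i (i x))), hPle n x, norm_nonneg x]
  have hQ4 : ∀ n x, ‖R n (i (adjoint i (R n (i (adjoint i x)))))‖ ≤ 4 * ‖x‖ := fun n x => by
    linarith [hQle n (R n (i (adjoint i x))), hQle n x, norm_nonneg x]
  have hdP : ∀ x, Tendsto (fun p => dJ p (adjoint i (i x))) atTop (𝓝 0) := fun x => by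
    rw [← prod_atTop_atTop_eq, ← sub_self x]
    exact ((hP x).comp tendsto_fst).sub ((hP x).comp tendsto_snd)
  have hdQ : ∀ x, Tendsto (fun p => dR p (i (adjoint i x))) atTop (𝓝 0) := fun x => by
    rw [← prod_atTop_atTop_eq, ← sub_self x]
    exact ((hQ x).comp tendsto_fst).sub ((hQ x).comp tendsto_snd)
  let h : ℕ × ℕ → ℝ → ℝ := fun p r =>
    inner ℝ (σ r) (dR p (i (adjoint i (dR p (i (adjoint i (i (u r)))))))) +
      inner ℝ (f r) (dJ p (adjoint i (i (dJ p (adjoint i (i (u r)))))))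
  have hmeas' : ∀ p, AEStronglyMeasurable (h p) (volume.restrict (Ioc 0 T)) := fun p =>
    hmeas (dJ p ∘L adjoint i ∘L i ∘L dJ p ∘L adjoint i ∘L i)
      (dR p ∘L i ∘L adjoint i ∘L dR p ∘L i ∘L adjoint i)
  have hbd' : ∀ p, ∀ᵐ r ∂(volume.restrict (Ioc 0 T)),
      ‖h p r‖ ≤ 4 * (‖σ r‖ * C + ‖f r‖ * ‖u r‖) := fun p =>
    hbd (dJ p ∘L adjoint i ∘L i ∘L dJ p ∘L adjoint i ∘L i)
      (dR p ∘L i ∘L adjoint i ∘L dR p ∘L i ∘L adjoint i)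
      (hdP4 p)
      (hdQ4 p)
  have hlim0 : Tendsto (fun p => ∫ r in Ioc 0 T, ‖h p r‖) atTop (𝓝 0) := by
    have := tendsto_integral_filter_of_dominated_convergence (l := (atTop : Filter (ℕ × ℕ)))
      (μ := volume.restrict (Ioc 0 T)) (F := fun p r => ‖h p r‖) (f := fun _ => (0 : ℝ)) _
      (Eventually.of_forall fun p => (hmeas' p).norm)
      (Eventually.of_forall fun p => by simpa using hbd' p) hbound ?_
    · simpa using this
    · filter_upwards with r
      have h1 : Tendsto (fun p => dJ p (adjoint i (i (dJ p (adjoint i (i (u r))))))) atTop (𝓝 0) := by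
        refine squeeze_zero_norm (fun p => hdPle p _) ?_
        simpa using ((hdP (u r)).norm.const_mul 2)
      have h2 : Tendsto (fun p => dR p (i (adjoint i (dR p (i (adjoint i (i (u r)))))))) atTop (𝓝 0) := by
        refine squeeze_zero_norm (fun p => hdQle p _) ?_
        simpa using ((hdQ (i (u r))).norm.const_mul 2)
      have h3 := ((tendsto_const_nhds (x := σ r)).inner (𝕜 := ℝ) h2).add
        ((tendsto_const_nhds (x := f r)).inner (𝕜 := ℝ) h1)
      simpa using h3.norm
  -- The right side does not depend on `s` and tends to `0`, so the smoothed functions are uniformly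
  -- Cauchy in `H`.
  have herr : ∀ p, ∀ s ∈ Icc 0 T, ‖i (dJ p (G s))‖ ^ 2
      ≤ ‖dR p (i (adjoint i g₀))‖ ^ 2 + 2 * ∫ r in Ioc 0 T, ‖h p r‖ := by
    intro p s hs
    have e := norm_sq_regularization i g₀ hσ hf1 hG (dJ p) (dR p)
      (fun x y => by simp only [dJ, sub_apply, inner_sub_left, inner_sub_right, hJs])
      (fun x => by simp only [dJ, dR, sub_apply, map_sub, hJR]) hs
    rw [hGdef, e]
    gcongr
    rw [intervalIntegral.integral_of_le hs.1]
    have hint : Integrable (h p) (volume.restrict (Ioc 0 T)) := hbound.mono' (hmeas' p) (hbd' p)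
    refine (Real.le_norm_self _).trans ((norm_integral_le_integral_norm (h p)).trans ?_)
    exact setIntegral_mono_set hint.norm (Eventually.of_forall fun _ => norm_nonneg _)
      (Ioc_subset_Ioc_right hs.2).eventuallyLE
  have hunif : UniformCauchySeqOn (fun n s => i (J n (G s))) atTop (Icc 0 T) := by
    rw [Metric.uniformCauchySeqOn_iff]
    intro δ hδ
    have hl : Tendsto (fun p => ‖dR p (i (adjoint i g₀))‖ ^ 2 + 2 * ∫ r in Ioc 0 T, ‖h p r‖) atTop
        (𝓝 0) := by
      simpa using ((hdQ g₀).norm.pow 2).add (hlim0.const_mul 2)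
    obtain ⟨⟨a, b⟩, hab⟩ := eventually_atTop.1 (hl.eventually (gt_mem_nhds (by positivity : 0 < δ ^ 2)))
    refine ⟨max a b, fun m hm n hn s hs => ?_⟩
    have h1 := herr (m, n) s hs
    have h2 := hab (m, n) ⟨(le_max_left _ _).trans hm, (le_max_right _ _).trans hn⟩
    rw [dist_eq_norm, ← map_sub]
    exact lt_of_pow_lt_pow_left₀ 2 hδ.le (h1.trans_lt h2)
  have hex : ∀ s, ∃ y, s ∈ Icc 0 T → Tendsto (fun n => i (J n (G s))) atTop (𝓝 y) := by
    intro s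
    by_cases hs : s ∈ Icc 0 T
    · obtain ⟨y, hy⟩ := cauchySeq_tendsto_of_complete (hunif.cauchySeq hs)
      exact ⟨y, fun _ => hy⟩
    · exact ⟨0, fun h => absurd h hs⟩
  choose g hg using hex
  have hgu : TendstoUniformlyOn (fun n s => i (J n (G s))) g atTop (Icc 0 T) :=
    hunif.tendstoUniformlyOn_of_tendsto fun s hs => hg s hs
  refine ⟨g, hgu.continuousOn (Frequently.of_forall fun n =>
    (i ∘L J n).continuous.comp_continuousOn hGc), fun s hs => ?_, fun s hs => ?_⟩
  · have h1 := ((adjoint i).continuous.tendsto _).comp (hg s hs)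
    -- `J n` commutes with `i† i`, and `J n i† i` tends strongly to the identity, so the limit
    -- satisfies `i† g = G` at every `s`.
    have h2 : ∀ n, (adjoint i) (i (J n (G s))) = J n (adjoint i (i (G s))) := fun n =>
      (regInv_comm hK (hε n) (G s)).symm
    refine tendsto_nhds_unique h1 ?_
    simp only [Function.comp_def, h2]
    exact hP _
  · have h1 : Tendsto (fun n => ‖i (J n (G s))‖ ^ 2) atTop (𝓝 (‖g s‖ ^ 2)) := (hg s hs).norm.pow 2
    refine tendsto_nhds_unique h1 ?_
    have h2 : ∀ n, ‖i (J n (G s))‖ ^ 2 = _ := fun n =>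
      norm_sq_regularization i g₀ hσ hf1 hG (J n) (R n) (hJs n) (hJR n) hs
    simp only [h2]
    refine ((hQ g₀).norm.pow 2).add (Tendsto.const_mul 2 ?_)
    simp only [intervalIntegral.integral_of_le hs.1]
    have hsub : Ioc 0 s ⊆ Ioc 0 T := Ioc_subset_Ioc_right hs.2
    refine tendsto_integral_filter_of_dominated_convergence (l := (atTop : Filter ℕ)) _
      (Eventually.of_forall fun n => ((hmeas (J n ∘L adjoint i ∘L i ∘L J n ∘L adjoint i ∘L i)
        (R n ∘L i ∘L adjoint i ∘L R n ∘L i ∘L adjoint i)).mono_set hsub))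
      (Eventually.of_forall fun n => ae_restrict_of_ae_restrict_of_subset hsub
        (hbd (J n ∘L adjoint i ∘L i ∘L J n ∘L adjoint i ∘L i)
        (R n ∘L i ∘L adjoint i ∘L R n ∘L i ∘L adjoint i)
        (hP4 n)
        (hQ4 n)))
      (hbound.mono_measure (Measure.restrict_mono hsub le_rfl)) ?_
    filter_upwards with r
    refine ((tendsto_const_nhds (x := σ r)).inner (𝕜 := ℝ) ?_).add
        ((tendsto_const_nhds (x := f r)).inner (𝕜 := ℝ) ?_)
    · exact tendsto_iterate_twice (fun n => R n ∘L i ∘L adjoint i) hQle (hQ _)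
    · exact tendsto_iterate_twice (fun n => J n ∘L adjoint i ∘L i) hPle (hP _)

end

/-! ### Existence for the abstract parabolic problem. -/

section

open Filter Topology ContinuousLinearMap

variable {V H : Type*} [NormedAddCommGroup V] [InnerProductSpace ℝ V] [CompleteSpace V]
  [NormedAddCommGroup H] [InnerProductSpace ℝ H] [CompleteSpace H]

theorem aestronglyMeasurable_clm_apply {E F : Type*} [NormedAddCommGroup E] [NormedSpace ℝ E]
    [NormedAddCommGroup F] [NormedSpace ℝ F] {α : Type*} [MeasurableSpace α] {ν : Measure α}
    {A : α → E →L[ℝ] F} {w : α → E}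
    (hA : AEStronglyMeasurable A ν) (hw : AEStronglyMeasurable w ν) :
    AEStronglyMeasurable (fun r => A r (w r)) ν :=
  (ContinuousLinearMap.id ℝ (E →L[ℝ] F)).aestronglyMeasurable_comp₂ hA hw

theorem integrable_clm_apply {E F : Type*} [NormedAddCommGroup E] [NormedSpace ℝ E]
    [NormedAddCommGroup F] [NormedSpace ℝ F] {α : Type*} [MeasurableSpace α] {ν : Measure α}
    {A : α → E →L[ℝ] F} {w : α → E} (hA : AEStronglyMeasurable A ν) {M : ℝ}
    (hM : ∀ᵐ r ∂ν, ‖A r‖ ≤ M) (hw : Integrable w ν) : Integrable (fun r => A r (w r)) ν := by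
  refine Integrable.mono' (hw.norm.const_mul M) (aestronglyMeasurable_clm_apply hA hw.1) ?_
  filter_upwards [hM] with r hr
  exact (le_opNorm _ _).trans (by gcongr)

theorem intervalIntegrable_of_mem_Icc {E : Type*} [NormedAddCommGroup E] {F : ℝ → E} {T s : ℝ}
    (hF : IntegrableOn F (Ioc 0 T)) (hs : s ∈ Icc 0 T) : IntervalIntegrable F volume 0 s :=
  (intervalIntegrable_iff_integrableOn_Ioc_of_le hs.1).2
    (hF.mono_set (Ioc_subset_Ioc_right hs.2))

/-- Solutions of the equation regularized by `ε u'`, with bounds uniform in `ε`. -/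
theorem exists_regularized_solution (i : V →L[ℝ] H) {T : ℝ} (hT : 0 ≤ T) {A : ℝ → V →L[ℝ] V}
    (hA : AEStronglyMeasurable A (volume.restrict (Ioc 0 T))) {M : ℝ} (hM0 : 0 ≤ M)
    (hM : ∀ᵐ r ∂(volume.restrict (Ioc 0 T)), ‖A r‖ ≤ M)
    (hpos : ∀ᵐ r ∂(volume.restrict (Ioc 0 T)), ∀ v, 0 ≤ inner ℝ (A r v) v)
    {c l : ℝ} (hl : 0 ≤ l)
    (hcoer : ∀ᵐ r ∂(volume.restrict (Ioc 0 T)), ∀ v,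
      c * ‖v‖ ^ 2 ≤ inner ℝ (A r v) v + l * ‖i v‖ ^ 2)
    (g₀ : H) {σ : ℝ → H} (hσ : IntegrableOn σ (Ioc 0 T)) {C : ℝ}
    (hC : C = ‖g₀‖ + 2 * ∫ r in (0 : ℝ)..T, ‖σ r‖) {ε : ℝ} (hε : 0 < ε) :
    ∃ u : ℝ → V, Continuous u ∧
      (∀ s ∈ Icc 0 T, adjoint i (i (u s)) + ε • u s
        = adjoint i g₀ + ∫ r in (0 : ℝ)..s, (adjoint i (σ r) - A r (u r))) ∧
      (∀ s ∈ Icc 0 T, ‖i (u s)‖ ≤ C) ∧ (∀ s ∈ Icc 0 T, ε * ‖u s‖ ^ 2 ≤ C ^ 2) ∧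
      c * ∫ r in (0 : ℝ)..T, ‖u r‖ ^ 2 ≤ C ^ 2 * (1 + l * T) := by
  have hK : (adjoint i ∘L i).IsPositive := isPositive_adjoint_comp_self i
  have hL : (i ∘L adjoint i).IsPositive := isPositive_self_comp_adjoint i
  set J := regInv (adjoint i ∘L i) ε with hJ
  have hσi : IntegrableOn (fun r => adjoint i (σ r)) (Ioc 0 T) := (adjoint i).integrable_comp hσ
  have hsub : ∀ s ∈ Icc 0 T, Ioc 0 s ⊆ Ioc 0 T := fun s hs => Ioc_subset_Ioc_right hs.2
  -- Applying `J = (i† i + ε)⁻¹` to the integrated equation gives `u = J (i† g₀ + ∫ i† σ) - ∫ J A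
  -- u`.
  obtain ⟨u, huc, hu⟩ := exists_volterra hT (A := fun r => -(J ∘L A r)) (M := ‖J‖ * M)
    (((compL ℝ V V V J).continuous.comp_aestronglyMeasurable hA).neg) (by positivity)
    (by filter_upwards [hM] with r hr
        rw [norm_neg]
        exact (opNorm_comp_le _ _).trans (by gcongr))
    (f := fun s => J (adjoint i g₀ + ∫ r in (0 : ℝ)..s, adjoint i (σ r)))
    (J.continuous.comp_continuousOn (continuousOn_const.add (continuousOn_primitive_Icc hT hσi)))
  have huM : IntegrableOn u (Ioc 0 T) :=
    (huc.continuousOn.integrableOn_Icc (a := 0) (b := T)).mono_set Ioc_subset_Icc_self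
  have hAu : IntegrableOn (fun r => A r (u r)) (Ioc 0 T) := integrable_clm_apply hA hM huM
  have hF : IntegrableOn (fun r => adjoint i (σ r) - A r (u r)) (Ioc 0 T) := hσi.sub hAu
  set G : ℝ → V := fun s => adjoint i g₀ + ∫ r in (0 : ℝ)..s, (adjoint i (σ r) - A r (u r)) with hG
  have huG : ∀ s ∈ Icc 0 T, u s = J (G s) := by
    intro s hs
    rw [hu s hs, hG]
    simp only [neg_apply, comp_apply]
    rw [intervalIntegral.integral_neg, J.intervalIntegral_comp_comm (intervalIntegrable_of_mem_Icc hAu hs),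
      intervalIntegral.integral_sub (intervalIntegrable_of_mem_Icc hσi hs) (intervalIntegrable_of_mem_Icc hAu hs), ← sub_eq_add_neg, ← map_sub]
    congr 1; abel
  have heq : ∀ s ∈ Icc 0 T, adjoint i (i (u s)) + ε • u s = G s := by
    intro s hs
    rw [huG s hs]
    exact regInv_right hK hε (G s)
  have hcross : Integrable (fun r => inner ℝ (σ r) (i (u r))) (volume.restrict (Ioc 0 T)) := by
    obtain ⟨D, hD⟩ := isCompact_Icc.exists_bound_of_continuousOn
      ((i.continuous.comp huc).continuousOn (s := Icc 0 T))
    refine Integrable.mono' (hσ.norm.mul_const D)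
      (hσ.1.inner (i.continuous.comp huc).aestronglyMeasurable) ?_
    filter_upwards [ae_restrict_mem measurableSet_Ioc] with r hr
    exact (norm_inner_le_norm _ _).trans (by gcongr; exact hD r (Ioc_subset_Icc_self hr))
  have hdiss : Integrable (fun r => inner ℝ (A r (u r)) (u r)) (volume.restrict (Ioc 0 T)) := by
    obtain ⟨D, hD⟩ := isCompact_Icc.exists_bound_of_continuousOn (huc.continuousOn (s := Icc 0 T))
    refine Integrable.mono' (hAu.norm.mul_const D) (hAu.1.inner huc.aestronglyMeasurable) ?_
    filter_upwards [ae_restrict_mem measurableSet_Ioc] with r hr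
    exact (norm_inner_le_norm _ _).trans (by gcongr; exact hD r (Ioc_subset_Icc_self hr))
  have henergy : ∀ s ∈ Icc 0 T, ‖i (u s)‖ ^ 2 + ε * ‖u s‖ ^ 2
      + 2 * (∫ r in (0 : ℝ)..s, inner ℝ (A r (u r)) (u r))
      ≤ ‖g₀‖ ^ 2 + 2 * ∫ r in (0 : ℝ)..s, inner ℝ (σ r) (i (u r)) := by
    intro s hs
    have h1 := quadratic_primitive J (inner_regInv hK hε) (adjoint i g₀) hs.1
      (hF.mono_set (hsub s hs))
    change inner ℝ (G s) (J (G s)) = _ + 2 * ∫ r in (0 : ℝ)..s, inner ℝ _ (J (G r)) at h1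
    have h2 : inner ℝ (G s) (J (G s)) = ‖i (u s)‖ ^ 2 + ε * ‖u s‖ ^ 2 := by
      rw [← huG s hs, ← heq s hs, inner_add_left, adjoint_inner_left, inner_smul_left,
        real_inner_self_eq_norm_sq, real_inner_self_eq_norm_sq]
      rfl
    -- `i J i†` equals `(i i† + ε)⁻¹ i i†`, a contraction of `H`; hence the initial energy is
    -- bounded uniformly in `ε`.
    have h3 : inner ℝ (adjoint i g₀) (J (adjoint i g₀)) ≤ ‖g₀‖ ^ 2 := by
      rw [adjoint_inner_left, hJ, comp_regInv i hε]
      refine (real_inner_le_norm _ _).trans ?_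
      rw [sq]
      gcongr
      exact norm_regInv_comp_le hL hε g₀
    have h4 : (∫ r in (0 : ℝ)..s, inner ℝ (adjoint i (σ r) - A r (u r)) (J (G r)))
        = (∫ r in (0 : ℝ)..s, inner ℝ (σ r) (i (u r)))
          - ∫ r in (0 : ℝ)..s, inner ℝ (A r (u r)) (u r) := by
      rw [← intervalIntegral.integral_sub (intervalIntegrable_of_mem_Icc hcross hs) (intervalIntegrable_of_mem_Icc hdiss hs)]
      refine intervalIntegral.integral_congr fun r hr => ?_
      rw [uIcc_of_le hs.1] at hr
      rw [← huG r ⟨hr.1, hr.2.trans hs.2⟩, inner_sub_left, adjoint_inner_left]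
    rw [h2, h4] at h1
    linarith
  have hdiss0 : ∀ s ∈ Icc 0 T, 0 ≤ ∫ r in (0 : ℝ)..s, inner ℝ (A r (u r)) (u r) := by
    intro s hs
    rw [intervalIntegral.integral_of_le hs.1]
    refine integral_nonneg_of_ae ?_
    filter_upwards [ae_restrict_of_ae_restrict_of_subset (hsub s hs) hpos] with r hr
    exact hr _
  set Q := ∫ r in (0 : ℝ)..T, ‖σ r‖ with hQ
  have hQ0 : 0 ≤ Q := intervalIntegral.integral_nonneg hT fun _ _ => norm_nonneg _
  have hcrossle : ∀ D, (∀ s ∈ Icc 0 T, ‖i (u s)‖ ≤ D) → ∀ s ∈ Icc 0 T,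
      ∫ r in (0 : ℝ)..s, inner ℝ (σ r) (i (u r)) ≤ D * Q := by
    intro D hD s hs
    have hD0 : 0 ≤ D := (norm_nonneg _).trans (hD s hs)
    have h1 : ∫ r in (0 : ℝ)..s, inner ℝ (σ r) (i (u r)) ≤ ∫ r in (0 : ℝ)..s, D * ‖σ r‖ := by
      refine intervalIntegral.integral_mono_on hs.1 (intervalIntegrable_of_mem_Icc hcross hs)
        (intervalIntegrable_of_mem_Icc (hσ.norm.const_mul D) hs) fun r hr => ?_
      refine (real_inner_le_norm _ _).trans ?_
      rw [mul_comm]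
      gcongr
      exact hD r ⟨hr.1, hr.2.trans hs.2⟩
    rw [intervalIntegral.integral_const_mul] at h1
    refine h1.trans (mul_le_mul_of_nonneg_left ?_ hD0)
    rw [hQ, intervalIntegral.integral_of_le hs.1, intervalIntegral.integral_of_le hT]
    exact setIntegral_mono_set hσ.norm (Eventually.of_forall fun _ => norm_nonneg _)
      (hsub s hs).eventuallyLE
  have hg0 := norm_nonneg g₀
  have hiu : ∀ s ∈ Icc 0 T, ‖i (u s)‖ ≤ C := by
    obtain ⟨s₁, hs₁, hmax⟩ := isCompact_Icc.exists_isMaxOn (nonempty_Icc.2 hT)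
      ((i.continuous.comp huc).norm.continuousOn (s := Icc 0 T))
    intro s hs
    refine (hmax hs).trans ?_
    have h1 := hcrossle _ (fun s hs => hmax hs) s₁ hs₁
    have h2 := henergy s₁ hs₁
    have h3 := hdiss0 s₁ hs₁
    have h4 : 0 ≤ ε * ‖u s₁‖ ^ 2 := by positivity
    simp only [Function.comp_apply] at h1 h2 ⊢
    set m := ‖i (u s₁)‖
    -- At the maximum `m` of `‖i u‖` the energy inequality gives `m² ≤ ‖g₀‖² + 2 m Q`, which fails
    -- as soon as `m > ‖g₀‖ + 2 Q`.
    by_contra! hlt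
    rw [hC] at hlt
    nlinarith [norm_nonneg (i (u s₁))]
  have hfin : ∀ s ∈ Icc 0 T, ‖g₀‖ ^ 2 + 2 * ∫ r in (0 : ℝ)..s, inner ℝ (σ r) (i (u r)) ≤ C ^ 2 := by
    intro s hs
    have h1 := hcrossle C hiu s hs
    rw [hC] at h1 ⊢
    nlinarith [mul_nonneg hg0 hQ0]
  refine ⟨u, huc, heq, hiu, fun s hs => ?_, ?_⟩
  · have h1 := henergy s hs
    have h2 := hfin s hs
    have h3 := hdiss0 s hs
    nlinarith [sq_nonneg ‖i (u s)‖]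
  · have hTm : T ∈ Icc 0 T := ⟨hT, le_rfl⟩
    have h1 := henergy T hTm
    have h2 := hfin T hTm
    have h3 : ∫ r in (0 : ℝ)..T, c * ‖u r‖ ^ 2
        ≤ ∫ r in (0 : ℝ)..T, (inner ℝ (A r (u r)) (u r) + l * C ^ 2) := by
      rw [intervalIntegral.integral_of_le hT, intervalIntegral.integral_of_le hT]
      refine integral_mono_ae ?_ (hdiss.add (integrable_const _)) ?_
      · exact ((continuous_const.mul (huc.norm.pow 2)).continuousOn.integrableOn_Icc).mono_set
          Ioc_subset_Icc_self
      · filter_upwards [hcoer, ae_restrict_mem measurableSet_Ioc] with r hr hrT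
        refine (hr (u r)).trans ?_
        have := hiu r (Ioc_subset_Icc_self hrT)
        gcongr
    rw [intervalIntegral.integral_const_mul,
      intervalIntegral.integral_add (intervalIntegrable_of_mem_Icc hdiss hTm) intervalIntegrable_const,
      intervalIntegral.integral_const, smul_eq_mul] at h3
    have h4 : 0 ≤ ε * ‖u T‖ ^ 2 := by positivity
    nlinarith [sq_nonneg ‖i (u T)‖, sq_nonneg C]

theorem norm_toLp_sq {α E : Type*} [MeasurableSpace α] {ν : Measure α} [NormedAddCommGroup E]
    [InnerProductSpace ℝ E] {u : α → E} (hu : MemLp u 2 ν) :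
    ‖hu.toLp u‖ ^ 2 = ∫ r, ‖u r‖ ^ 2 ∂ν := by
  rw [← real_inner_self_eq_norm_sq, L2.inner_def]
  refine integral_congr_ae ?_
  filter_upwards [hu.coeFn_toLp] with r hr
  rw [hr, real_inner_self_eq_norm_sq]

theorem tendsto_setIntegral_clm_apply {α E F : Type*} [MeasurableSpace α] {ν : Measure α}
    [IsFiniteMeasure ν] [NormedAddCommGroup E] [NormedSpace ℝ E]
    [NormedAddCommGroup F] [NormedSpace ℝ F]
    {A : α → E →L[ℝ] F} (hA : AEStronglyMeasurable A ν) {M : ℝ}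
    (hM : ∀ᵐ r ∂ν, ‖A r‖ ≤ M) {w : ℕ → Lp E 2 ν} {u : Lp E 2 ν} (hw : Tendsto w atTop (𝓝 u))
    (t : Set α) :
    Tendsto (fun n => ∫ r in t, A r (w n r) ∂ν) atTop (𝓝 (∫ r in t, A r (u r) ∂ν)) := by
  have hint : ∀ v : Lp E 2 ν, Integrable (fun r => A r (v r)) ν := fun v =>
    integrable_clm_apply hA hM ((Lp.memLp v).integrable (by norm_num))
  refine tendsto_setIntegral_of_L1' _ (hint u).1 (Eventually.of_forall fun n => hint (w n)) ?_ t
  have h1 := (Lp.tendsto_Lp_iff_tendsto_eLpNorm' _ _).1 hw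
  have hne : ν univ ^ (1 / (1 : ENNReal).toReal - 1 / (2 : ENNReal).toReal) ≠ ⊤ :=
    ENNReal.rpow_ne_top_of_nonneg (by norm_num) (measure_ne_top ν _)
  have h2 := ENNReal.Tendsto.const_mul (a := ENNReal.ofReal M)
    (ENNReal.Tendsto.mul_const h1 (Or.inr hne)) (Or.inr ENNReal.ofReal_ne_top)
  rw [zero_mul, mul_zero] at h2
  refine tendsto_of_tendsto_of_tendsto_of_le_of_le tendsto_const_nhds h2 (fun _ => bot_le)
    fun n => ?_
  refine (eLpNorm_le_mul_eLpNorm_of_ae_le_mul (c := M) (g := ⇑(w n) - ⇑u) ?_ 1).trans ?_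
  · filter_upwards [hM] with r hr
    simp only [Pi.sub_apply, ← map_sub]
    exact (le_opNorm _ _).trans (by gcongr)
  · gcongr
    exact eLpNorm_le_eLpNorm_mul_rpow_measure_univ (by norm_num)
      ((Lp.aestronglyMeasurable _).sub (Lp.aestronglyMeasurable _))

/-- Existence of a weak solution `u ∈ L²(0,T;V)` of `(i† i u)' + A u = i† σ`, `i u(0) = g₀`. -/
theorem exists_weak_solution (i : V →L[ℝ] H) {T : ℝ} (hT : 0 ≤ T) {A : ℝ → V →L[ℝ] V}
    (hA : AEStronglyMeasurable A (volume.restrict (Ioc 0 T))) {M : ℝ} (hM0 : 0 ≤ M)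
    (hM : ∀ᵐ r ∂(volume.restrict (Ioc 0 T)), ‖A r‖ ≤ M)
    (hpos : ∀ᵐ r ∂(volume.restrict (Ioc 0 T)), ∀ v, 0 ≤ inner ℝ (A r v) v)
    {c l : ℝ} (hc : 0 < c) (hl : 0 ≤ l)
    (hcoer : ∀ᵐ r ∂(volume.restrict (Ioc 0 T)), ∀ v,
      c * ‖v‖ ^ 2 ≤ inner ℝ (A r v) v + l * ‖i v‖ ^ 2)
    (g₀ : H) {σ : ℝ → H} (hσ : IntegrableOn σ (Ioc 0 T)) :
    ∃ (u : ℝ → V) (C : ℝ), MemLp u 2 (volume.restrict (Ioc 0 T)) ∧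
      (∀ᵐ s ∂(volume.restrict (Ioc 0 T)), ‖i (u s)‖ ≤ C) ∧
      ∀ᵐ s ∂(volume.restrict (Ioc 0 T)), adjoint i (i (u s))
        = adjoint i g₀ + ∫ r in (0 : ℝ)..s, (adjoint i (σ r) - A r (u r)) := by
  set ν := volume.restrict (Ioc (0 : ℝ) T) with hν
  let C : ℝ := ‖g₀‖ + 2 * ∫ r in (0 : ℝ)..T, ‖σ r‖
  have hC0 : 0 ≤ C := add_nonneg (norm_nonneg _)
    (mul_nonneg (by norm_num) (intervalIntegral.integral_nonneg hT fun _ _ => norm_nonneg _))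
  have hσi : IntegrableOn (fun r => adjoint i (σ r)) (Ioc 0 T) := (adjoint i).integrable_comp hσ
  have hAw : ∀ w : Lp V 2 ν, IntegrableOn (fun r => A r (w r)) (Ioc 0 T) := fun w =>
    integrable_clm_apply hA hM ((Lp.memLp w).integrable (by norm_num))
  let D : ℝ → V := fun s => adjoint i g₀ + ∫ r in (0 : ℝ)..s, adjoint i (σ r)
  -- The residual of the integrated equation. It is affine in `w`, which makes the sets `Z n` below
  -- convex.
  let P : Lp V 2 ν → ℝ → V := fun w s => adjoint i (i (w s)) + (∫ r in Ioc 0 s, A r (w r)) - D s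
  have hDsplit : ∀ v : ℝ → V, IntegrableOn (fun r => A r (v r)) (Ioc 0 T) → ∀ s ∈ Icc 0 T,
      adjoint i g₀ + ∫ r in (0 : ℝ)..s, (adjoint i (σ r) - A r (v r))
        = D s - ∫ r in Ioc 0 s, A r (v r) := by
    intro v hv s hs
    rw [intervalIntegral.integral_sub (intervalIntegrable_of_mem_Icc hσi hs)
      (intervalIntegrable_of_mem_Icc hv hs), ← intervalIntegral.integral_of_le hs.1, ← add_sub_assoc]
  have hcongr : ∀ v w : ℝ → V, v =ᵐ[ν] w → ∀ s ∈ Icc 0 T,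
      ∫ r in Ioc 0 s, A r (v r) = ∫ r in Ioc 0 s, A r (w r) := by
    intro v w hvw s hs
    refine integral_congr_ae ?_
    filter_upwards [ae_restrict_of_ae_restrict_of_subset (Ioc_subset_Ioc_right hs.2) hvw] with r hr
    rw [hr]
  let ε : ℕ → ℝ := fun n => 1 / ((n : ℝ) + 1)
  have hε : ∀ n, 0 < ε n := fun n => by positivity
  have hεanti : Antitone ε := fun n m h => by simp only [ε]; gcongr
  let Z : ℕ → Set (Lp V 2 ν) := fun n =>
    {w | ∀ᵐ s ∂ν, ‖P w s‖ ≤ √(ε n) * C ∧ ‖i (w s)‖ ≤ C}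
  have hZanti : Antitone Z := by
    intro n m h w hw
    have hw' : ∀ᵐ s ∂ν, ‖P w s‖ ≤ √(ε m) * C ∧ ‖i (w s)‖ ≤ C := hw
    change ∀ᵐ s ∂ν, ‖P w s‖ ≤ √(ε n) * C ∧ ‖i (w s)‖ ≤ C
    filter_upwards [hw'] with s hs
    refine ⟨hs.1.trans ?_, hs.2⟩
    have := hεanti h
    gcongr
  have hZconv : ∀ n, Convex ℝ (Z n) := by
    intro n w hw v hv a b ha hb hab
    filter_upwards [hw, hv, Lp.coeFn_add (a • w) (b • v), Lp.coeFn_smul a w, Lp.coeFn_smul b v,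
      ae_restrict_mem measurableSet_Ioc] with s hws hvs h1 h2 h3 hs
    have e1 : (a • w + b • v : Lp V 2 ν) s = a • w s + b • v s := by
      rw [h1, Pi.add_apply, h2, h3]; rfl
    have e2 : ∫ r in Ioc 0 s, A r ((a • w + b • v : Lp V 2 ν) r)
        = a • (∫ r in Ioc 0 s, A r (w r)) + b • ∫ r in Ioc 0 s, A r (v r) := by
      rw [hcongr _ (fun r => a • w r + b • v r) ?_ s (Ioc_subset_Icc_self hs), ← integral_smul,
        ← integral_smul, ← integral_add]
      · simp only [map_add, map_smul]
      · exact ((hAw w).mono_set (Ioc_subset_Ioc_right hs.2)).smul a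
      · exact ((hAw v).mono_set (Ioc_subset_Ioc_right hs.2)).smul b
      · filter_upwards [Lp.coeFn_add (a • w) (b • v), Lp.coeFn_smul a w, Lp.coeFn_smul b v]
          with r h1 h2 h3
        rw [h1, Pi.add_apply, h2, h3]; rfl
    have e3 : P (a • w + b • v) s = a • P w s + b • P v s := by
      have : D s = a • D s + b • D s := by rw [← add_smul, hab, one_smul]
      simp only [P]
      rw [e1, e2]
      conv_lhs => rw [this]
      simp only [map_add, map_smul, smul_sub, smul_add]
      abel
    constructor
    · rw [e3]
      refine (norm_add_le _ _).trans ?_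
      rw [norm_smul, norm_smul, Real.norm_of_nonneg ha, Real.norm_of_nonneg hb]
      calc a * ‖P w s‖ + b * ‖P v s‖ ≤ a * (√(ε n) * C) + b * (√(ε n) * C) := by
            gcongr
            · exact hws.1
            · exact hvs.1
        _ = √(ε n) * C := by rw [← add_mul, hab, one_mul]
    · rw [e1, map_add, map_smul, map_smul]
      refine (norm_add_le _ _).trans ?_
      rw [norm_smul, norm_smul, Real.norm_of_nonneg ha, Real.norm_of_nonneg hb]
      calc a * ‖i (w s)‖ + b * ‖i (v s)‖ ≤ a * C + b * C := by
            gcongr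
            · exact hws.2
            · exact hvs.2
        _ = C := by rw [← add_mul, hab, one_mul]
  have hZne : ∀ n, ∃ w ∈ Z n, ‖w‖ ≤ √(C ^ 2 * (1 + l * T) / c) := by
    intro n
    obtain ⟨u, huc, hu, hiu, hεu, hL2⟩ := exists_regularized_solution i hT hA hM0 hM hpos hl hcoer
      g₀ hσ (C := C) rfl (hε n)
    obtain ⟨B, hB⟩ := isCompact_Icc.exists_bound_of_continuousOn (huc.continuousOn (s := Icc 0 T))
    have hum : MemLp u 2 ν := MemLp.of_bound huc.aestronglyMeasurable B (by
      filter_upwards [ae_restrict_mem measurableSet_Ioc] with r hr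
      exact hB r (Ioc_subset_Icc_self hr))
    have hAu : IntegrableOn (fun r => A r (u r)) (Ioc 0 T) :=
      integrable_clm_apply hA hM (hum.integrable (by norm_num))
    refine ⟨hum.toLp u, ?_, ?_⟩
    · filter_upwards [hum.coeFn_toLp, ae_restrict_mem measurableSet_Ioc] with s hs hsT
      have hsI := Ioc_subset_Icc_self hsT
      refine ⟨?_, by rw [hs]; exact hiu s hsI⟩
      have e1 := hu s hsI
      rw [hDsplit u hAu s hsI] at e1
      -- The regularized solution misses the equation by `ε u`, and `ε ‖u‖² ≤ C²` turns this into an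
      -- error of at most `√ε C`.
      have e2 : P (hum.toLp u) s = -(ε n • u s) := by
        simp only [P]
        rw [hcongr _ _ hum.coeFn_toLp s hsI, hs, eq_neg_iff_add_eq_zero]
        rw [eq_sub_iff_add_eq] at e1
        rw [← sub_eq_zero] at e1
        rw [← e1]; abel
      rw [e2, norm_neg, norm_smul, Real.norm_of_nonneg (hε n).le]
      refine le_of_sq_le_sq ?_ (by positivity)
      rw [mul_pow, mul_pow, Real.sq_sqrt (hε n).le]
      have := mul_le_mul_of_nonneg_left (hεu s hsI) (hε n).le
      linarith
    · refine Real.le_sqrt_of_sq_le ?_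
      rw [norm_toLp_sq, le_div_iff₀ hc, mul_comm]
      rwa [intervalIntegral.integral_of_le hT] at hL2
  obtain ⟨w, u, hwZ, hwu⟩ := exists_tendsto_mem_of_antitone_convex Z hZanti hZconv _ hZne
  -- Strong convergence yields an almost everywhere convergent subsequence, so both pointwise
  -- constraints pass to the limit.
  obtain ⟨ns, hns, hae⟩ := (tendstoInMeasure_of_tendsto_Lp hwu).exists_seq_tendsto_ae
  have hall := ae_all_iff.2 hwZ
  refine ⟨u, C, Lp.memLp u, ?_, ?_⟩
  · filter_upwards [hae, hall] with s hs h
    exact le_of_tendsto ((i.continuous.tendsto _).comp hs).norm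
      (Eventually.of_forall fun k => (h (ns k)).2)
  · filter_upwards [hae, hall, ae_restrict_mem measurableSet_Ioc] with s hs h hsT
    have h1 : Tendsto (fun k => P (w (ns k)) s) atTop (𝓝 (P u s)) := by
      refine Tendsto.sub_const (Tendsto.add ?_ ?_) _
      · exact ((adjoint i ∘L i).continuous.tendsto _).comp hs
      · have := (tendsto_setIntegral_clm_apply hA hM hwu (Ioc 0 s)).comp hns.tendsto_atTop
        have hr : ν.restrict (Ioc 0 s) = volume.restrict (Ioc 0 s) := by
          rw [hν, Measure.restrict_restrict measurableSet_Ioc,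
            inter_eq_left.2 (Ioc_subset_Ioc_right hsT.2)]
        simpa only [Function.comp_def, hr] using this
    have h2 : Tendsto (fun k => √(ε (ns k)) * C) atTop (𝓝 0) := by
      have := (Real.continuous_sqrt.tendsto _).comp
        ((tendsto_one_div_add_atTop_nhds_zero_nat (𝕜 := ℝ)).comp hns.tendsto_atTop)
      simpa [Function.comp_def, ε] using this.mul_const C
    have h3 : P u s = 0 :=
      tendsto_nhds_unique h1 (squeeze_zero_norm (fun k => (h (ns k)).1) h2)
    rw [hDsplit u (hAw u) s (Ioc_subset_Icc_self hsT), eq_sub_iff_add_eq]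
    exact sub_eq_zero.1 h3

end

/-! ### Weak derivatives and traces on the half-line through primitives. -/

namespace BoundaryLayer

open Filter Topology

/-- The primitive `Z ↦ ∫₀^Z w` of `w ∈ L²(ℝ₊)`, extended by `0` to the left. -/
noncomputable def prim (w : L2Pos) (Z : ℝ) : ℝ := ∫ t in (0 : ℝ)..Z, (Ioi (0 : ℝ)).indicator w t

/-- `u` is the primitive of `w` that vanishes at `0`. -/
def IsPrim (u w : L2Pos) : Prop := ∀ᵐ Z ∂(volume.restrict (Ioi (0 : ℝ))), u Z = prim w Z

theorem memLp_indicator (w : L2Pos) : MemLp ((Ioi (0 : ℝ)).indicator w) 2 volume :=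
  (memLp_indicator_iff_restrict measurableSet_Ioi).2 (Lp.memLp w)

theorem intervalIntegrable_indicator (w : L2Pos) (a b : ℝ) :
    IntervalIntegrable ((Ioi (0 : ℝ)).indicator w) volume a b := by
  exact (((memLp_indicator w).locallyIntegrable (by norm_num)).integrableOn_isCompact
    isCompact_uIcc).intervalIntegrable

theorem continuous_prim (w : L2Pos) : Continuous (prim w) :=
  intervalIntegral.continuous_primitive (intervalIntegrable_indicator w) 0

theorem prim_zero_right (w : L2Pos) : prim w 0 = 0 := by simp [prim]

/-- Writing the primitive as a pairing with the indicator of `(0, Z]` makes its linearity and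
`L²`-continuity in `w` immediate. -/
theorem prim_eq_inner (w : L2Pos) {Z : ℝ} (hZ : 0 ≤ Z) :
    prim w Z = inner ℝ (indicatorConstLp (μ := volume.restrict (Ioi (0 : ℝ))) 2
      (measurableSet_Ioc : MeasurableSet (Ioc 0 Z))
      ((Measure.restrict_apply_le _ _).trans_lt (by simp)).ne (1 : ℝ)) w := by
  rw [L2.inner_indicatorConstLp_one, prim, intervalIntegral.integral_of_le hZ,
    Measure.restrict_restrict measurableSet_Ioc, inter_eq_left.2 Ioc_subset_Ioi_self]
  exact setIntegral_congr_fun measurableSet_Ioc fun t ht => indicator_of_mem (mem_Ioi.2 ht.1) _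

theorem IsPrim.zero : IsPrim 0 0 := by
  filter_upwards [Lp.coeFn_zero ℝ 2 (volume.restrict (Ioi (0 : ℝ))), ae_restrict_mem measurableSet_Ioi]
    with Z h hZ
  rw [h, prim_eq_inner _ (le_of_lt hZ), inner_zero_right]; rfl

theorem IsPrim.add {u w u' w' : L2Pos} (h : IsPrim u w) (h' : IsPrim u' w') :
    IsPrim (u + u') (w + w') := by
  filter_upwards [h, h', Lp.coeFn_add u u', ae_restrict_mem measurableSet_Ioi] with Z h1 h2 h3 hZ
  rw [h3, Pi.add_apply, h1, h2, prim_eq_inner _ (le_of_lt hZ), prim_eq_inner _ (le_of_lt hZ),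
    prim_eq_inner _ (le_of_lt hZ), inner_add_right]

theorem IsPrim.smul {u w : L2Pos} (c : ℝ) (h : IsPrim u w) : IsPrim (c • u) (c • w) := by
  filter_upwards [h, Lp.coeFn_smul c u, ae_restrict_mem measurableSet_Ioi] with Z h1 h3 hZ
  rw [h3, Pi.smul_apply, h1, prim_eq_inner _ (le_of_lt hZ), prim_eq_inner _ (le_of_lt hZ),
    inner_smul_right, smul_eq_mul]

theorem isClosed_isPrim : IsClosed {p : L2Pos × L2Pos | IsPrim p.1 p.2} := by
  refine IsSeqClosed.isClosed fun p q hp hpq => ?_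
  have h1 : Tendsto (fun n => (p n).1) atTop (𝓝 q.1) := (continuous_fst.tendsto q).comp hpq
  have h2 : Tendsto (fun n => (p n).2) atTop (𝓝 q.2) := (continuous_snd.tendsto q).comp hpq
  obtain ⟨ns, hns, hae⟩ := (tendstoInMeasure_of_tendsto_Lp h1).exists_seq_tendsto_ae
  change IsPrim q.1 q.2
  filter_upwards [hae, ae_all_iff.2 hp, ae_restrict_mem measurableSet_Ioi] with Z h3 h4 hZ
  refine tendsto_nhds_unique h3 ?_
  simp only [h4, prim_eq_inner _ (le_of_lt (mem_Ioi.1 hZ))]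
  exact tendsto_const_nhds.inner (h2.comp hns.tendsto_atTop)

theorem IsPrim.hasTrace {u w : L2Pos} (h : IsPrim u w) : HasTrace u 0 :=
  ⟨prim w, (continuous_prim w).continuousOn, h, prim_zero_right w⟩

theorem exists_Icc_of_isCompact_subset_Ioi {K : Set ℝ} (hK : IsCompact K) (hK0 : K ⊆ Ioi 0) :
    ∃ a b, 0 < a ∧ a ≤ b ∧ K ⊆ Icc a b := by
  rcases K.eq_empty_or_nonempty with rfl | hne
  · exact ⟨1, 1, one_pos, le_rfl, empty_subset _⟩
  · exact ⟨sInf K, sSup K, hK0 (hK.sInf_mem hne), csInf_le_csSup hne hK.bddBelow hK.bddAbove,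
      fun x hx => ⟨csInf_le hK.bddBelow hx, le_csSup hK.bddAbove hx⟩⟩

theorem exists_Icc_of_tsupport_subset_Ioi {φ : ℝ → ℝ} (hc : HasCompactSupport φ)
    (hs : tsupport φ ⊆ Ioi 0) : ∃ a b, 0 < a ∧ a ≤ b ∧ ∀ x, x ∉ Icc a b → φ x = 0 := by
  obtain ⟨a, b, ha, hab, h⟩ := exists_Icc_of_isCompact_subset_Ioi hc hs
  exact ⟨a, b, ha, hab, fun x hx => image_eq_zero_of_notMem_tsupport fun hx' => hx (h hx')⟩

theorem deriv_eq_zero_of_notMem_Icc {φ : ℝ → ℝ} {a b : ℝ} (h : ∀ x, x ∉ Icc a b → φ x = 0) {x : ℝ}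
    (hx : x ∉ Icc a b) : deriv φ x = 0 := by
  have : φ =ᶠ[𝓝 x] fun _ => 0 := by
    filter_upwards [isClosed_Icc.isOpen_compl.mem_nhds hx] with y hy using h y hy
  rw [this.deriv_eq, deriv_const]

/-- An integral over `(0, ∞)` of a function that vanishes beyond `b`. -/
theorem integral_Ioi_eq_intervalIntegral {f : ℝ → ℝ} {b : ℝ} (hb : 0 ≤ b)
    (h : ∀ x, b < x → f x = 0) : ∫ Z in Ioi (0 : ℝ), f Z = ∫ Z in (0 : ℝ)..b, f Z := by
  rw [intervalIntegral.integral_of_le hb]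
  refine setIntegral_eq_of_subset_of_forall_sdiff_eq_zero measurableSet_Ioi Ioc_subset_Ioi_self ?_
  intro x hx
  refine h x (not_le.1 fun hxb => hx.2 ⟨hx.1, hxb⟩)

theorem prim_mul_prim (w : L2Pos) {f : ℝ → ℝ} {R : ℝ} (hR : 0 ≤ R)
    (hf : IntegrableOn f (Ioc 0 R)) :
    prim w R * (∫ t in (0 : ℝ)..R, f t)
      = (∫ Z in (0 : ℝ)..R, (Ioi (0 : ℝ)).indicator w Z * ∫ t in (0 : ℝ)..Z, f t)
        + ∫ Z in (0 : ℝ)..R, prim w Z * f Z :=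
  bilin_primitive (ContinuousLinearMap.mul ℝ ℝ) hR
    ((intervalIntegrable_iff_integrableOn_Ioc_of_le hR).1 (intervalIntegrable_indicator w 0 R)) hf

theorem integral_prim_mul_deriv (w : L2Pos) {φ : ℝ → ℝ} (hφ : ContDiff ℝ ∞ φ)
    (hc : HasCompactSupport φ) (hs : tsupport φ ⊆ Ioi 0) :
    ∫ Z in Ioi (0 : ℝ), prim w Z * deriv φ Z = -∫ Z in Ioi (0 : ℝ), w Z * φ Z := by
  obtain ⟨a, b, ha, hab, h0⟩ := exists_Icc_of_tsupport_subset_Ioi hc hs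
  have hb : 0 ≤ b := ha.le.trans hab
  have hφc : Continuous (deriv φ) := hφ.continuous_deriv (by simp)
  have hint : ∀ Z, ∫ t in (0 : ℝ)..Z, deriv φ t = φ Z := by
    intro Z
    rw [intervalIntegral.integral_deriv_eq_sub
      (fun x _ => (hφ.differentiable (by simp)).differentiableAt) (hφc.intervalIntegrable _ _),
      h0 0 (fun h => absurd h.1 (not_le.2 ha)), sub_zero]
  -- `φ` is known to vanish only outside `[a, b]`, so the integration by parts runs up to `b + 1`,
  -- where the boundary term is zero.
  have hb1 : φ (b + 1) = 0 := h0 _ fun h => absurd h.2 (by linarith [h.2])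
  have h1 := prim_mul_prim w (f := deriv φ) (R := b + 1) (by linarith)
    (hφc.continuousOn.integrableOn_Icc.mono_set Ioc_subset_Icc_self)
  simp only [hint, hb1, mul_zero] at h1
  have h2 : ∫ Z in Ioi (0 : ℝ), w Z * φ Z
      = ∫ Z in Ioi (0 : ℝ), (Ioi (0 : ℝ)).indicator w Z * φ Z :=
    setIntegral_congr_fun measurableSet_Ioi fun Z hZ => by simp only [indicator_of_mem hZ]
  rw [h2, integral_Ioi_eq_intervalIntegral (b := b + 1) (by linarith),
    integral_Ioi_eq_intervalIntegral (b := b + 1) (by linarith)]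
  · linarith
  · intro x hx; rw [h0 x fun h => absurd h.2 (by linarith), mul_zero]
  · intro x hx
    rw [deriv_eq_zero_of_notMem_Icc h0 fun h => absurd h.2 (by linarith), mul_zero]

theorem IsPrim.isWeakDeriv {u w : L2Pos} (h : IsPrim u w) : IsWeakDeriv u w := by
  intro φ hφ hc hs
  rw [← integral_prim_mul_deriv w hφ hc hs]
  refine integral_congr_ae ?_
  filter_upwards [h] with Z hZ
  rw [hZ]

/-- A continuous function on `(0, ∞)` with vanishing distributional derivative is constant. -/
theorem ae_eq_const_of_integral_mul_deriv_eq_zero {D : ℝ → ℝ} (hD : ContinuousOn D (Ioi 0))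
    (h : ∀ φ : ℝ → ℝ, ContDiff ℝ ∞ φ → HasCompactSupport φ → tsupport φ ⊆ Ioi 0 →
      ∫ Z in Ioi (0 : ℝ), D Z * deriv φ Z = 0) :
    ∃ k, ∀ᵐ Z ∂(volume.restrict (Ioi (0 : ℝ))), D Z = k := by
  have hint : ∀ ψ : ℝ → ℝ, Continuous ψ → HasCompactSupport ψ → tsupport ψ ⊆ Ioi 0 →
      IntegrableOn (fun Z => D Z * ψ Z) (Ioi 0) := by
    intro ψ hψ hc hs
    obtain ⟨a, b, ha, hab, h0⟩ := exists_Icc_of_tsupport_subset_Ioi hc hs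
    have hsub : Icc a b ⊆ Ioi 0 := fun x hx => ha.trans_le hx.1
    refine IntegrableOn.of_forall_sdiff_eq_zero (s := Icc a b)
      ((hD.mono hsub).mul hψ.continuousOn).integrableOn_Icc measurableSet_Ioi ?_
    intro x hx; simp only [h0 x hx.2, mul_zero]
  -- Centre `2` and outer radius `1` keep the support in `[1, 3]`, away from the boundary.
  let β : ContDiffBump (2 : ℝ) := ⟨1 / 2, 1, by norm_num, by norm_num⟩
  let ρ : ℝ → ℝ := β.normed volume
  have hρ : ContDiff ℝ ∞ ρ := β.contDiff_normed
  have hρc : HasCompactSupport ρ := β.hasCompactSupport_normed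
  have hρs : tsupport ρ ⊆ Ioi 0 := by
    rw [β.tsupport_normed_eq, Real.closedBall_eq_Icc]
    intro x hx
    have h1 := hx.1
    have h2 : β.rOut = 1 := rfl
    rw [h2] at h1
    rw [mem_Ioi]; linarith
  have hρ1 : ∫ Z, ρ Z = 1 := β.integral_normed
  have hIoi : ∀ ψ : ℝ → ℝ, tsupport ψ ⊆ Ioi 0 → ∀ f : ℝ → ℝ,
      ∫ Z in Ioi (0 : ℝ), f Z * ψ Z = ∫ Z, f Z * ψ Z := by
    intro ψ hs f
    refine setIntegral_eq_integral_of_forall_compl_eq_zero fun Z hZ => ?_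
    rw [image_eq_zero_of_notMem_tsupport fun h => hZ (hs h), mul_zero]
  let k : ℝ := ∫ Z in Ioi (0 : ℝ), D Z * ρ Z
  refine ⟨k, ?_⟩
  have key := isOpen_Ioi.ae_eq_zero_of_integral_contDiff_smul_eq_zero
    (U := Ioi (0 : ℝ)) (μ := volume) (f := fun Z => D Z - k)
    ((hD.sub continuousOn_const).locallyIntegrableOn measurableSet_Ioi) (by
      intro ψ hψ hc hs
      set m := ∫ Z, ψ Z with hm
      -- Subtracting `m ρ` makes the integral zero, so the primitive of `χ` has compact support and
      -- is an admissible test function; this gives `∫ D ψ = k ∫ ψ`.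
      let χ : ℝ → ℝ := fun Z => ψ Z - m * ρ Z
      have hχ : ContDiff ℝ ∞ χ := hψ.sub (contDiff_const.mul hρ)
      obtain ⟨a, b, ha, hab, h0⟩ := exists_Icc_of_isCompact_subset_Ioi (hc.isCompact.union hρc.isCompact)
        (union_subset hs hρs)
      have hψ0 : ∀ x, x ∉ Icc a b → ψ x = 0 := fun x hx =>
        image_eq_zero_of_notMem_tsupport fun h => hx (h0 (Or.inl h))
      have hρ0 : ∀ x, x ∉ Icc a b → ρ x = 0 := fun x hx =>
        image_eq_zero_of_notMem_tsupport fun h => hx (h0 (Or.inr h))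
      have hχ0 : ∀ x, x ∉ Icc a b → χ x = 0 := fun x hx => by
        simp only [χ, hψ0 x hx, hρ0 x hx, mul_zero, sub_zero]
      have hχint : ∫ Z, χ Z = 0 := by
        rw [integral_sub (hψ.continuous.integrable_of_hasCompactSupport hc)
          ((hρ.continuous.integrable_of_hasCompactSupport hρc).const_mul m),
          integral_const_mul, hρ1, mul_one, ← hm, sub_self]
      let φ : ℝ → ℝ := fun Z => ∫ t in a..Z, χ t
      have hderiv : ∀ Z, HasDerivAt φ (χ Z) Z := fun Z =>
        intervalIntegral.integral_hasDerivAt_right (hχ.continuous.intervalIntegrable _ _)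
          (hχ.continuous.stronglyMeasurableAtFilter _ _) hχ.continuous.continuousAt
      have hderiv' : deriv φ = χ := funext fun Z => (hderiv Z).deriv
      have hφ : ContDiff ℝ ∞ φ := by
        rw [contDiff_infty_iff_deriv, hderiv']
        exact ⟨fun Z => (hderiv Z).differentiableAt, hχ⟩
      have hφ0 : ∀ x, x ∉ Icc a b → φ x = 0 := by
        intro x hx
        rcases lt_or_ge x a with hxa | hxa
        · refine intervalIntegral.integral_zero_ae ?_
          filter_upwards [Measure.ae_ne volume a] with t hta ht
          rw [uIoc_of_ge hxa.le] at ht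
          exact hχ0 t fun h => hta (le_antisymm ht.2 h.1)
        · have hbx : b < x := not_le.1 fun h => hx ⟨hxa, h⟩
          have : ∫ t in a..x, χ t = ∫ t, χ t := by
            rw [intervalIntegral.integral_of_le hxa, ← integral_Icc_eq_integral_Ioc]
            refine setIntegral_eq_integral_of_forall_compl_eq_zero fun t ht => hχ0 t fun h => ?_
            exact ht ⟨h.1, h.2.trans hbx.le⟩
          simp only [φ, this, hχint]
      have hφs : tsupport φ ⊆ Icc a b := closure_minimal
        (fun x hx => by by_contra hx'; exact hx (hφ0 x hx')) isClosed_Icc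
      have h1 := h φ hφ (HasCompactSupport.of_support_subset_isCompact isCompact_Icc
        (subset_closure.trans hφs)) (hφs.trans fun x hx => ha.trans_le hx.1)
      rw [hderiv'] at h1
      have h2 : ∫ Z in Ioi (0 : ℝ), D Z * ψ Z = m * k := by
        have e : ∀ Z, D Z * χ Z = D Z * ψ Z - m * (D Z * ρ Z) := fun Z => by simp only [χ]; ring
        simp only [e] at h1
        rw [integral_sub (hint ψ hψ.continuous hc hs) ((hint ρ hρ.continuous hρc hρs).const_mul m),
          integral_const_mul] at h1
        linarith
      have h3 : ∀ Z, ψ Z • (D Z - k) = (D Z - k) * ψ Z := fun Z => by rw [smul_eq_mul, mul_comm]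
      simp only [h3]
      rw [← hIoi ψ hs]
      have e : ∀ Z, (D Z - k) * ψ Z = D Z * ψ Z - k * ψ Z := fun Z => by ring
      simp only [e]
      rw [integral_sub (hint ψ hψ.continuous hc hs)
        ((hψ.continuous.integrable_of_hasCompactSupport hc).integrableOn.const_mul k), h2,
        hIoi ψ hs, integral_const_mul, ← hm]
      ring)
  rw [ae_restrict_iff' measurableSet_Ioi]
  filter_upwards [key] with Z hZ hZ'
  exact sub_eq_zero.1 (hZ hZ')

/-- The continuous representative minus `prim w` has zero distributional derivative, so it is
constant, and its value at `0` is zero. With `IsPrim.isWeakDeriv` and `IsPrim.hasTrace`, weak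
derivative plus zero trace becomes the single linear, closed relation `IsPrim`. -/
theorem IsWeakDeriv.isPrim {u w : L2Pos} (h : IsWeakDeriv u w) (h0 : HasTrace u 0) :
    IsPrim u w := by
  obtain ⟨v, hv, huv, hv0⟩ := h0
  have hvc : ContinuousOn v (Ioi 0) := hv.mono Ioi_subset_Ici_self
  have hDc : ContinuousOn (fun Z => v Z - prim w Z) (Ici 0) := hv.sub (continuous_prim w).continuousOn
  obtain ⟨k, hk⟩ := ae_eq_const_of_integral_mul_deriv_eq_zero (D := fun Z => v Z - prim w Z)
    (hDc.mono Ioi_subset_Ici_self) (by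
      intro φ hφ hc hs
      have hφ' : HasCompactSupport (deriv φ) := hc.deriv
      have hφc : Continuous (deriv φ) := hφ.continuous_deriv (by simp)
      have hφ2 : MemLp (deriv φ) 2 (volume.restrict (Ioi (0 : ℝ))) :=
        hφc.memLp_of_hasCompactSupport hφ'
      have h1 : ∫ Z in Ioi (0 : ℝ), v Z * deriv φ Z = ∫ Z in Ioi (0 : ℝ), u Z * deriv φ Z :=
        integral_congr_ae (by filter_upwards [huv] with Z hZ; rw [hZ])
      have h2 : Integrable (fun Z => v Z * deriv φ Z) (volume.restrict (Ioi (0 : ℝ))) :=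
        (MemLp.integrable_mul (Lp.memLp u) hφ2).congr
          (by filter_upwards [huv] with Z hZ; simp only [Pi.mul_apply, hZ])
      have h3 : Integrable (fun Z => prim w Z * deriv φ Z) (volume.restrict (Ioi (0 : ℝ))) :=
        (((continuous_prim w).mul hφc).integrable_of_hasCompactSupport hφ'.mul_left).integrableOn
      simp only [sub_mul]
      rw [integral_sub h2 h3, h1, h φ hφ hc hs, integral_prim_mul_deriv w hφ hc hs, sub_self])
  have heq : EqOn (fun Z => v Z - prim w Z) (fun _ => k) (Ioi 0) :=
    Measure.eqOn_open_of_ae_eq hk isOpen_Ioi (hDc.mono Ioi_subset_Ici_self) continuousOn_const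
  have heq' : EqOn (fun Z => v Z - prim w Z) (fun _ => k) (Ici 0) :=
    heq.of_subset_closure hDc continuousOn_const Ioi_subset_Ici_self (by rw [closure_Ioi])
  have hk0 : k = 0 := by
    have := heq' (self_mem_Ici (a := (0 : ℝ)))
    simp only [hv0, prim_zero_right, sub_zero] at this
    exact this.symm
  filter_upwards [huv, ae_restrict_mem measurableSet_Ioi] with Z h1 hZ
  have := heq hZ
  simp only [hk0] at this
  rw [h1]; linarith

theorem inner_eq_integral (f g : L2Pos) : inner ℝ f g = ∫ Z in Ioi (0 : ℝ), f Z * g Z := by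
  rw [L2.inner_def]
  refine integral_congr_ae (Eventually.of_forall fun Z => ?_)
  simp [mul_comm]

theorem integrable_mul (f g : L2Pos) : IntegrableOn (fun Z => f Z * g Z) (Ioi (0 : ℝ)) :=
  MemLp.integrable_mul (Lp.memLp f) (Lp.memLp g)

/-- Integration by parts for functions that vanish at `0`. -/
theorem IsPrim.inner_add_inner_eq_zero {u w u' w' : L2Pos} (h : IsPrim u w) (h' : IsPrim u' w') :
    inner ℝ w u' + inner ℝ u w' = 0 := by
  have hint1 : IntegrableOn (fun Z => w Z * prim w' Z) (Ioi (0 : ℝ)) :=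
    (integrable_mul w u').congr (by filter_upwards [h'] with Z hZ; rw [hZ])
  have hint2 : IntegrableOn (fun Z => prim w Z * w' Z) (Ioi (0 : ℝ)) :=
    (integrable_mul u w').congr (by filter_upwards [h] with Z hZ; rw [hZ])
  have e1 : inner ℝ w u' + inner ℝ u w' = ∫ Z in Ioi (0 : ℝ), (w Z * prim w' Z + prim w Z * w' Z) := by
    rw [integral_add hint1 hint2, inner_eq_integral, inner_eq_integral]
    congr 1 <;> refine integral_congr_ae ?_
    · filter_upwards [h'] with Z hZ; rw [hZ]
    · filter_upwards [h] with Z hZ; rw [hZ]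
  have hlim := intervalIntegral_tendsto_integral_Ioi 0 (hint1.add hint2) tendsto_id
  rw [e1]
  have hprod : ∀ R, 0 ≤ R → ∫ Z in (0 : ℝ)..R, (w Z * prim w' Z + prim w Z * w' Z)
      = prim w R * prim w' R := by
    intro R hR
    have hsub : Ioc 0 R ⊆ Ioi (0 : ℝ) := Ioc_subset_Ioi_self
    have h1 := prim_mul_prim w (f := (Ioi (0 : ℝ)).indicator w') hR
      ((intervalIntegrable_iff_integrableOn_Ioc_of_le hR).1 (intervalIntegrable_indicator w' 0 R))
    change prim w R * prim w' R = (∫ Z in (0 : ℝ)..R, (Ioi (0 : ℝ)).indicator w Z * prim w' Z) + _ at h1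
    rw [h1, intervalIntegral.integral_of_le hR, intervalIntegral.integral_of_le hR,
      intervalIntegral.integral_of_le hR, integral_add (hint1.mono_set hsub) (hint2.mono_set hsub)]
    congr 1 <;> refine setIntegral_congr_fun measurableSet_Ioc fun Z hZ => ?_
    · simp only [indicator_of_mem (hsub hZ)]
    · simp only [indicator_of_mem (hsub hZ)]
  have hlim' : Tendsto (fun R => prim w R * prim w' R) atTop
      (𝓝 (∫ Z in Ioi (0 : ℝ), (w Z * prim w' Z + prim w Z * w' Z))) := by
    refine hlim.congr' ?_
    filter_upwards [eventually_ge_atTop 0] with R hR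
    exact hprod R hR
  -- The boundary term at infinity has a limit, and it is integrable because it equals `u u'` almost
  -- everywhere; the limit must therefore be `0`.
  refine IntegrableAtFilter.eq_zero_of_tendsto (l := atTop) (μ := volume) ?_ ?_ hlim'
  · refine ⟨Ioi 0, Ioi_mem_atTop 0, (integrable_mul u u').congr ?_⟩
    filter_upwards [h, h'] with Z h1 h2
    rw [h1, h2]
  · intro s hs
    obtain ⟨a, ha⟩ := mem_atTop_sets.1 hs
    exact top_le_iff.1 ((Real.volume_Ici (a := a)).symm.le.trans (measure_mono fun x hx => ha x hx))

theorem IsPrim.inner_eq_zero {u w : L2Pos} (h : IsPrim u w) : inner ℝ w u = 0 := by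
  have := h.inner_add_inner_eq_zero h
  rw [real_inner_comm w u] at this
  linarith

/-- Interpolation: `‖∂u‖² = -⟨u, ∂²u⟩` by parts, then Cauchy–Schwarz. -/
theorem IsPrim.norm_sq_le {u w z : L2Pos} (h : IsPrim u w) (h' : IsPrim w z) :
    ‖w‖ ^ 2 ≤ ‖u‖ * ‖z‖ := by
  have := h.inner_add_inner_eq_zero h'
  rw [real_inner_self_eq_norm_sq] at this
  have h2 := abs_real_inner_le_norm u z
  have h3 := neg_abs_le (inner ℝ u z)
  linarith

theorem isPrim_toLp_deriv {φ : ℝ → ℝ} (hφ : ContDiff ℝ ∞ φ) (hs : tsupport φ ⊆ Ioi 0)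
    (h : MemLp φ 2 (volume.restrict (Ioi (0 : ℝ))))
    (h' : MemLp (deriv φ) 2 (volume.restrict (Ioi (0 : ℝ)))) :
    IsPrim (h.toLp φ) (h'.toLp (deriv φ)) := by
  have hφc : Continuous (deriv φ) := hφ.continuous_deriv (by simp)
  filter_upwards [h.coeFn_toLp, ae_restrict_mem measurableSet_Ioi] with Z hZ hZ0
  have hZ0' : (0 : ℝ) ≤ Z := le_of_lt hZ0
  rw [hZ, prim, intervalIntegral.integral_of_le hZ0']
  have h1 : ∫ t in Ioc 0 Z, (Ioi (0 : ℝ)).indicator (h'.toLp (deriv φ)) t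
      = ∫ t in Ioc 0 Z, deriv φ t := by
    refine integral_congr_ae ?_
    filter_upwards [ae_restrict_of_ae_restrict_of_subset Ioc_subset_Ioi_self h'.coeFn_toLp,
      ae_restrict_mem measurableSet_Ioc] with t ht ht0
    rw [indicator_of_mem (mem_Ioi.2 ht0.1), ht]
  rw [h1, ← intervalIntegral.integral_of_le hZ0', intervalIntegral.integral_deriv_eq_sub
      (fun x _ => (hφ.differentiable (by simp)).differentiableAt) (hφc.intervalIntegrable _ _),
      image_eq_zero_of_notMem_tsupport fun h : (0 : ℝ) ∈ tsupport φ => lt_irrefl (0 : ℝ) (hs h), sub_zero]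

end BoundaryLayer

/-! ### Scalar inequalities. -/

/-- A nonlinear Gronwall inequality: `φ² ≤ x² + 2 ∫ a φ` implies `φ ≤ x + ∫ a`. -/
theorem le_add_integral_of_sq_le {T x : ℝ} (hx : 0 ≤ x) {φ a : ℝ → ℝ}
    (hφ : ContinuousOn φ (Icc 0 T)) (ha : IntegrableOn a (Ioc 0 T)) (ha0 : ∀ r, 0 ≤ a r)
    (h : ∀ s ∈ Icc 0 T, φ s ^ 2 ≤ x ^ 2 + 2 * ∫ r in (0 : ℝ)..s, a r * φ r) {s : ℝ}
    (hs : s ∈ Icc 0 T) : φ s ≤ x + ∫ r in (0 : ℝ)..s, a r := by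
  have hT : 0 ≤ T := hs.1.trans hs.2
  have hA : ContinuousOn (fun s => ∫ r in (0 : ℝ)..s, a r) (Icc 0 T) :=
    continuousOn_primitive_Icc hT ha
  refine le_of_forall_pos_le_add fun δ hδ => ?_
  by_contra! hlt
  let y : ℝ → ℝ := fun s => (x + δ) + ∫ r in (0 : ℝ)..s, a r
  have hy : ContinuousOn y (Icc 0 T) := continuousOn_const.add hA
  let B : Set ℝ := {s ∈ Icc 0 T | y s ≤ φ s}
  have hBc : IsCompact B := by
    have : B = Icc 0 T ∩ (fun s => φ s - y s) ⁻¹' Ici 0 := by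
      ext s; simp [B, sub_nonneg]
    rw [this]
    exact isCompact_Icc.of_isClosed_subset
      ((hφ.sub hy).preimage_isClosed_of_isClosed isClosed_Icc isClosed_Ici) inter_subset_left
  -- At the first time `t` with `y ≤ φ`, the bound `φ ≤ y` on `(0, t)` gives `φ(t)² ≤ x² + 2 ∫ a y`.
  -- Since `y(t)² = (x + δ)² + 2 ∫ a y`, this is strictly below `y(t)²`, a contradiction; the shift
  -- `δ` makes it strict.
  obtain ⟨t, ⟨htT, hty⟩, hmin⟩ := hBc.exists_isLeast ⟨s, hs, by simp only [y]; linarith⟩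
  have hsub : Ioc 0 t ⊆ Ioc 0 T := Ioc_subset_Ioc_right htT.2
  have hsub' : Icc 0 t ⊆ Icc 0 T := Icc_subset_Icc_right htT.2
  have hle : ∀ r ∈ Ioo 0 t, φ r ≤ y r := fun r hr => by
    by_contra! hr'
    exact absurd (hmin ⟨⟨hr.1.le, hr.2.le.trans htT.2⟩, hr'.le⟩) (not_le.2 hr.2)
  have hai : ∀ f : ℝ → ℝ, ContinuousOn f (Icc 0 T) →
      IntervalIntegrable (fun r => a r * f r) volume 0 t := fun f hf => by
    refine IntervalIntegrable.mul_continuousOn (intervalIntegrable_of_mem_Icc ha htT) ?_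
    rw [uIcc_of_le htT.1]; exact hf.mono hsub'
  have h1 : ∫ r in (0 : ℝ)..t, a r * φ r ≤ ∫ r in (0 : ℝ)..t, a r * y r :=
    intervalIntegral.integral_mono_on_of_le_Ioo htT.1 (hai φ hφ) (hai y hy)
      fun r hr => mul_le_mul_of_nonneg_left (hle r hr) (ha0 r)
  have h2 := quadratic_primitive (ContinuousLinearMap.id ℝ ℝ) (fun _ _ => rfl) (x + δ) htT.1
    (ha.mono_set hsub)
  have h3 : y t ^ 2 = (x + δ) ^ 2 + 2 * ∫ r in (0 : ℝ)..t, a r * y r := by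
    simp only [ContinuousLinearMap.id_apply, RCLike.inner_apply, conj_trivial] at h2
    simp only [mul_comm (a _), y, sq]
    linarith
  have h4 := h t htT
  have hyt : 0 ≤ y t := by
    have : 0 ≤ ∫ r in (0 : ℝ)..t, a r := intervalIntegral.integral_nonneg htT.1 fun r _ => ha0 r
    simp only [y]; linarith
  nlinarith

theorem ae_norm_le_of_memLp_top {α : Type*} [MeasurableSpace α] {ν : Measure α} {f : α → ℝ}
    (hf : MemLp f ⊤ ν) : ∀ᵐ x ∂ν, ‖f x‖ ≤ (eLpNorm f ⊤ ν).toReal := by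
  filter_upwards [ae_le_eLpNormEssSup (f := f) (μ := ν)] with x hx
  rw [← eLpNorm_exponent_top] at hx
  have := (ENNReal.toReal_le_toReal enorm_ne_top hf.2.ne).2 hx
  simpa using this

/-! ### The space `V` as a Hilbert space of jets, and the problem on it. -/

namespace BoundaryLayer

open Filter Topology ContinuousLinearMap

/-- The space `V` as a subspace of `L²(ℝ₊)³`, consisting of the triples `(v, ∂v, ∂²v)`. -/
def jets : Submodule ℝ (PiLp 2 fun _ : Fin 3 => L2Pos) where
  carrier := {x | IsPrim (x 0) (x 1) ∧ IsPrim (x 1) (x 2)}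
  zero_mem' := ⟨IsPrim.zero, IsPrim.zero⟩
  add_mem' := fun hx hy => ⟨hx.1.add hy.1, hx.2.add hy.2⟩
  smul_mem' := fun c _ hx => ⟨hx.1.smul c, hx.2.smul c⟩

theorem isClosed_jets : IsClosed (jets : Set (PiLp 2 fun _ : Fin 3 => L2Pos)) := by
  have h : ∀ k : Fin 3, Continuous fun x : PiLp 2 fun _ : Fin 3 => L2Pos => x k := fun k =>
    (PiLp.proj (𝕜 := ℝ) 2 (fun _ : Fin 3 => L2Pos) k).continuous
  exact (isClosed_isPrim.preimage ((h 0).prodMk (h 1))).inter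
    (isClosed_isPrim.preimage ((h 1).prodMk (h 2)))

instance : CompleteSpace jets := isClosed_jets.completeSpace_coe

/-- The `k`-th derivative as a bounded operator `V → L²(ℝ₊)`. -/
noncomputable def jetProj (k : Fin 3) : jets →L[ℝ] L2Pos :=
  PiLp.proj (𝕜 := ℝ) 2 (fun _ : Fin 3 => L2Pos) k ∘L jets.subtypeL

theorem isPrim_zero (v : jets) : IsPrim (jetProj 0 v) (jetProj 1 v) := v.2.1

theorem isPrim_one (v : jets) : IsPrim (jetProj 1 v) (jetProj 2 v) := v.2.2

theorem weakDeriv_zero (v : jets) : weakDeriv (jetProj 0 v) = jetProj 1 v :=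
  (isPrim_zero v).isWeakDeriv.weakDeriv_eq

theorem weakDeriv_one (v : jets) : weakDeriv (jetProj 1 v) = jetProj 2 v :=
  (isPrim_one v).isWeakDeriv.weakDeriv_eq

theorem memV_jetProj (v : jets) : MemV (jetProj 0 v) := by
  refine ⟨⟨⟨_, (isPrim_zero v).isWeakDeriv⟩, ?_⟩, (isPrim_zero v).hasTrace, ?_⟩
  · rw [weakDeriv_zero]; exact ⟨_, (isPrim_one v).isWeakDeriv⟩
  · rw [weakDeriv_zero]; exact (isPrim_one v).hasTrace

theorem isWeakDeriv_weakDeriv {u : L2Pos} (h : MemH1 u) : IsWeakDeriv u (weakDeriv u) := by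
  obtain ⟨w, hw⟩ := h
  rwa [hw.weakDeriv_eq]

theorem MemV.mem_jets {v : L2Pos} (h : MemV v) :
    WithLp.toLp 2 ![v, weakDeriv v, weakDeriv (weakDeriv v)] ∈ jets :=
  ⟨(isWeakDeriv_weakDeriv h.1.1).isPrim h.2.1, (isWeakDeriv_weakDeriv h.1.2).isPrim h.2.2⟩

theorem MemV.exists_jet {v : L2Pos} (h : MemV v) : ∃ w : jets, jetProj 0 w = v ∧
    jetProj 1 w = weakDeriv v ∧ jetProj 2 w = weakDeriv (weakDeriv v) :=
  ⟨⟨_, h.mem_jets⟩, rfl, rfl, rfl⟩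

theorem jets_ext {v w : jets} (h : jetProj 0 v = jetProj 0 w) : v = w := by
  have h1 : jetProj 1 v = jetProj 1 w := by rw [← weakDeriv_zero, h, weakDeriv_zero]
  have h2 : jetProj 2 v = jetProj 2 w := by rw [← weakDeriv_one, h1, weakDeriv_one]
  refine Subtype.ext (PiLp.ext fun k => ?_)
  fin_cases k
  · exact h
  · exact h1
  · exact h2

theorem injective_jetProj_zero : Function.Injective (jetProj 0) := fun _ _ => jets_ext

theorem norm_sq_jet (v : jets) :
    ‖v‖ ^ 2 = ‖jetProj 0 v‖ ^ 2 + ‖jetProj 1 v‖ ^ 2 + ‖jetProj 2 v‖ ^ 2 := by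
  have : ‖v‖ = ‖(v : PiLp 2 fun _ : Fin 3 => L2Pos)‖ := rfl
  rw [this, PiLp.norm_sq_eq_of_L2, Fin.sum_univ_three]
  rfl

/-- The middle derivative is absorbed by interpolation; this is the source of coercivity. -/
theorem norm_sq_jet_le (v : jets) :
    ‖v‖ ^ 2 ≤ 2 * (‖jetProj 2 v‖ ^ 2 + ‖jetProj 0 v‖ ^ 2) := by
  have := (isPrim_zero v).norm_sq_le (isPrim_one v)
  rw [norm_sq_jet]
  nlinarith [sq_nonneg (‖jetProj 0 v‖ - ‖jetProj 2 v‖), sq_nonneg ‖jetProj 0 v‖,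
    sq_nonneg ‖jetProj 2 v‖]

theorem inner_jetProj_one_zero (v : jets) : inner ℝ (jetProj 1 v) (jetProj 0 v) = 0 :=
  (isPrim_zero v).inner_eq_zero

/-- Test functions lie in `V`, so that `V` is dense in `L²(ℝ₊)`. -/
theorem injective_adjoint_jetProj_zero : Function.Injective (adjoint (jetProj 0)) := by
  rw [injective_iff_map_eq_zero]
  intro f hf
  have hmem : ∀ φ : ℝ → ℝ, ContDiff ℝ ∞ φ → HasCompactSupport φ →
      MemLp φ 2 (volume.restrict (Ioi (0 : ℝ))) := fun φ hφ hc =>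
    hφ.continuous.memLp_of_hasCompactSupport hc
  have hdsub : ∀ φ : ℝ → ℝ, tsupport (deriv φ) ⊆ tsupport φ := fun φ =>
    closure_minimal support_deriv_subset (isClosed_tsupport φ)
  apply Lp.ext
  have key := isOpen_Ioi.ae_eq_zero_of_integral_contDiff_smul_eq_zero
    (U := Ioi (0 : ℝ)) (μ := volume) (f := f)
    (locallyIntegrableOn_of_locallyIntegrable_restrict
      ((Lp.memLp f).locallyIntegrable (by norm_num))) (by
      intro φ hφ hc hs
      have hφ' : ContDiff ℝ ∞ (deriv φ) := (contDiff_infty_iff_deriv.1 hφ).2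
      have hφ'' : ContDiff ℝ ∞ (deriv (deriv φ)) := (contDiff_infty_iff_deriv.1 hφ').2
      have m0 := hmem φ hφ hc
      have m1 := hmem _ hφ' hc.deriv
      have m2 := hmem _ hφ'' hc.deriv.deriv
      let v : jets := ⟨WithLp.toLp 2 ![m0.toLp _, m1.toLp _, m2.toLp _],
        isPrim_toLp_deriv hφ hs m0 m1,
        isPrim_toLp_deriv hφ' ((hdsub φ).trans hs) m1 m2⟩
      have h1 : inner ℝ f (jetProj 0 v) = 0 := by
        rw [← adjoint_inner_left, hf, inner_zero_left]
      have h2 : ∫ Z in Ioi (0 : ℝ), φ Z • f Z = 0 := by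
        refine Eq.trans ?_ h1
        rw [inner_eq_integral]
        refine integral_congr_ae ?_
        filter_upwards [m0.coeFn_toLp] with Z hZ
        have : (jetProj 0 v) Z = φ Z := hZ
        rw [this, smul_eq_mul, mul_comm]
      refine (setIntegral_eq_integral_of_forall_compl_eq_zero ?_).symm.trans h2
      intro Z hZ
      rw [image_eq_zero_of_notMem_tsupport fun h => hZ (hs h), zero_smul])
  rw [EventuallyEq, ae_restrict_iff' measurableSet_Ioi]
  filter_upwards [key, (ae_restrict_iff' measurableSet_Ioi).1
    (Lp.coeFn_zero ℝ 2 (volume.restrict (Ioi (0 : ℝ))))] with Z hZ h0 hZ'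
  rw [hZ hZ', h0 hZ']; rfl

/-- The operator of the bilinear form `b ⟨j₁ u, j₀ v⟩ + μ ⟨j₂ u, j₂ v⟩`. -/
noncomputable def formOp {V H : Type*} [NormedAddCommGroup V] [InnerProductSpace ℝ V]
    [CompleteSpace V] [NormedAddCommGroup H] [InnerProductSpace ℝ H] [CompleteSpace H]
    (j₀ j₁ j₂ : V →L[ℝ] H) (b μ : ℝ → ℝ) (r : ℝ) : V →L[ℝ] V :=
  b r • (adjoint j₀ ∘L j₁) + μ r • (adjoint j₂ ∘L j₂)

section

variable {V H : Type*} [NormedAddCommGroup V] [InnerProductSpace ℝ V] [CompleteSpace V]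
  [NormedAddCommGroup H] [InnerProductSpace ℝ H] [CompleteSpace H] (j₀ j₁ j₂ : V →L[ℝ] H)
  {b μ : ℝ → ℝ} {ν : Measure ℝ}

theorem inner_formOp (r : ℝ) (u v : V) : inner ℝ (formOp j₀ j₁ j₂ b μ r u) v
    = b r * inner ℝ (j₁ u) (j₀ v) + μ r * inner ℝ (j₂ u) (j₂ v) := by
  simp only [formOp, add_apply, smul_apply, comp_apply, inner_add_left, real_inner_smul_left,
    adjoint_inner_left]

theorem aestronglyMeasurable_formOp (hb : MemLp b ⊤ ν) (hμ : MemLp μ ⊤ ν) :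
    AEStronglyMeasurable (formOp j₀ j₁ j₂ b μ) ν :=
  (hb.1.smul_const _).add (hμ.1.smul_const _)

theorem exists_norm_formOp_le (hb : MemLp b ⊤ ν) (hμ : MemLp μ ⊤ ν) :
    ∃ M, 0 ≤ M ∧ ∀ᵐ r ∂ν, ‖formOp j₀ j₁ j₂ b μ r‖ ≤ M := by
  refine ⟨(eLpNorm b ⊤ ν).toReal * ‖adjoint j₀ ∘L j₁‖
    + (eLpNorm μ ⊤ ν).toReal * ‖adjoint j₂ ∘L j₂‖, by positivity, ?_⟩
  filter_upwards [ae_norm_le_of_memLp_top hb, ae_norm_le_of_memLp_top hμ] with r h1 h2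
  refine (norm_add_le _ _).trans ?_
  rw [norm_smul, norm_smul]
  gcongr

theorem memLp_formOp_apply (hb : MemLp b ⊤ ν) (hμ : MemLp μ ⊤ ν) {u : ℝ → V} (hu : MemLp u 2 ν) :
    MemLp (fun r => formOp j₀ j₁ j₂ b μ r (u r)) 2 ν := by
  obtain ⟨M, -, hM⟩ := exists_norm_formOp_le j₀ j₁ j₂ hb hμ
  refine MemLp.of_le_mul (c := M) hu
    (aestronglyMeasurable_clm_apply (aestronglyMeasurable_formOp j₀ j₁ j₂ hb hμ) hu.1) ?_
  filter_upwards [hM] with r hr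
  exact (le_opNorm _ _).trans (by gcongr)

end

/-- The operator of the bilinear form `b ⟨∂u, v⟩ + μ ⟨∂²u, ∂²v⟩` on `V`. -/
noncomputable def coeffOp (b μ : ℝ → ℝ) (r : ℝ) : jets →L[ℝ] jets :=
  formOp (jetProj 0) (jetProj 1) (jetProj 2) b μ r

theorem inner_coeffOp (b μ : ℝ → ℝ) (r : ℝ) (u v : jets) : inner ℝ (coeffOp b μ r u) v
    = b r * inner ℝ (jetProj 1 u) (jetProj 0 v) + μ r * inner ℝ (jetProj 2 u) (jetProj 2 v) :=
  inner_formOp _ _ _ r u v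

/-- The transport term vanishes because `⟨∂u, u⟩ = 0` when `u` is zero at the boundary, whatever the
sign of `b`. -/
theorem inner_coeffOp_self (b μ : ℝ → ℝ) (r : ℝ) (u : jets) :
    inner ℝ (coeffOp b μ r u) u = μ r * ‖jetProj 2 u‖ ^ 2 := by
  rw [inner_coeffOp, inner_jetProj_one_zero, mul_zero, zero_add, real_inner_self_eq_norm_sq]

theorem memLp_coeffOp_apply {b μ : ℝ → ℝ} {ν : Measure ℝ}
    (hb : MemLp b ⊤ ν) (hμ : MemLp μ ⊤ ν) {u : ℝ → jets} (hu : MemLp u 2 ν) :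
    MemLp (fun r => coeffOp b μ r (u r)) 2 ν :=
  memLp_formOp_apply _ _ _ hb hμ hu

theorem inner_weak_form {T : ℝ} {b μ : ℝ → ℝ} (g₀ : L2Pos) {S : ℝ → L2Pos} {u : ℝ → jets}
    (hS : IntegrableOn S (Ioc 0 T)) (hu : IntegrableOn (fun r => coeffOp b μ r (u r)) (Ioc 0 T))
    {s : ℝ} (hs : s ∈ Icc 0 T) (v : jets) :
    inner ℝ (adjoint (jetProj 0) g₀
        + ∫ r in (0 : ℝ)..s, (adjoint (jetProj 0) (S r) - coeffOp b μ r (u r))) v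
      = inner ℝ g₀ (jetProj 0 v) + ((∫ r in (0 : ℝ)..s, inner ℝ (S r) (jetProj 0 v))
        - ∫ r in (0 : ℝ)..s, (b r * inner ℝ (jetProj 1 (u r)) (jetProj 0 v)
          + μ r * inner ℝ (jetProj 2 (u r)) (jetProj 2 v))) := by
  have hS' : IntegrableOn (fun r => adjoint (jetProj 0) (S r)) (Ioc 0 T) :=
    (adjoint (jetProj 0)).integrable_comp hS
  have hc : ∀ F : ℝ → jets, IntegrableOn F (Ioc 0 T) →
      inner ℝ (∫ r in (0 : ℝ)..s, F r) v = ∫ r in (0 : ℝ)..s, inner ℝ (F r) v := by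
    intro F hF
    have := (innerSL ℝ v).intervalIntegral_comp_comm (intervalIntegrable_of_mem_Icc hF hs)
    simp only [innerSL_apply_apply] at this
    rw [real_inner_comm, ← this]
    simp only [real_inner_comm]
  rw [intervalIntegral.integral_sub (intervalIntegrable_of_mem_Icc hS' hs)
    (intervalIntegrable_of_mem_Icc hu hs), inner_add_left, inner_sub_left, hc _ hS', hc _ hu]
  simp only [adjoint_inner_left, inner_coeffOp]

/-- Recovers a jet from its components by bounded operators defined on all of `L²(ℝ₊)`, so a lift
built by this formula inherits measurability and integrability without choosing jets pointwise. -/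
theorem sum_adjoint_jetProj (w : jets) : adjoint (jetProj 0) (jetProj 0 w)
    + adjoint (jetProj 1) (jetProj 1 w) + adjoint (jetProj 2) (jetProj 2 w) = w := by
  refine ext_inner_right ℝ fun x => ?_
  simp only [inner_add_left, adjoint_inner_left]
  rw [Submodule.coe_inner, PiLp.inner_apply, Fin.sum_univ_three]
  rfl

/-- Translates a solution into the abstract setting; `isSolution_of_lift` goes back. Testing with
all `v ∈ V` is equality of vectors in `jets`. -/
theorem IsSolution.exists_lift {T : ℝ} {b μ : ℝ → ℝ}
    (hb : MemLp b ⊤ (volume.restrict (Ioc 0 T))) (hμ : MemLp μ ⊤ (volume.restrict (Ioc 0 T)))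
    {gin : L2Pos} {S : ℝ → L2Pos} (hS : IntegrableOn S (Ioc 0 T)) {g : ℝ → L2Pos}
    (hg : IsSolution T b μ gin S g) :
    ∃ u : ℝ → jets, MemLp u 2 (volume.restrict (Ioc 0 T)) ∧
      (∀ᵐ s ∂(volume.restrict (Ioc 0 T)), jetProj 0 (u s) = g s) ∧
      ∀ s ∈ Icc 0 T, adjoint (jetProj 0) (g s) = adjoint (jetProj 0) gin
        + ∫ r in (0 : ℝ)..s, (adjoint (jetProj 0) (S r) - coeffOp b μ r (u r)) := by
  have hν : volume.restrict (Ioo 0 T) = volume.restrict (Ioc 0 T) :=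
    Measure.restrict_congr_set Ioo_ae_eq_Ioc
  obtain ⟨hcont, hH2, hL0, hL1, hL2, hbd, hinit, heq⟩ := hg
  rw [hν] at hH2 hL0 hL1 hL2 hbd
  let u : ℝ → jets := fun s => adjoint (jetProj 0) (g s)
    + adjoint (jetProj 1) (weakDeriv (g s)) + adjoint (jetProj 2) (weakDeriv (weakDeriv (g s)))
  have hu : MemLp u 2 (volume.restrict (Ioc 0 T)) :=
    (((adjoint (jetProj 0)).comp_memLp' hL0).add ((adjoint (jetProj 1)).comp_memLp' hL1)).add
      ((adjoint (jetProj 2)).comp_memLp' hL2)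
  have hjet : ∀ᵐ s ∂(volume.restrict (Ioc 0 T)), jetProj 0 (u s) = g s ∧
      jetProj 1 (u s) = weakDeriv (g s) ∧ jetProj 2 (u s) = weakDeriv (weakDeriv (g s)) := by
    filter_upwards [hH2, hbd] with s h1 h2
    obtain ⟨w, hw0, hw1, hw2⟩ := MemV.exists_jet ⟨h1, h2.1, h2.2⟩
    have : u s = w := by
      simp only [u]
      rw [← hw0, weakDeriv_zero, weakDeriv_one, sum_adjoint_jetProj]
    rw [this]
    exact ⟨hw0, hw1, hw2⟩
  refine ⟨u, hu, hjet.mono fun s h => h.1, fun s hs => ext_inner_right ℝ fun v => ?_⟩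
  have hA : IntegrableOn (fun r => coeffOp b μ r (u r)) (Ioc 0 T) :=
    (memLp_coeffOp_apply hb hμ hu).integrable (by norm_num)
  rw [inner_weak_form gin hS hA hs, adjoint_inner_left]
  have h1 := heq _ (memV_jetProj v) s hs
  rw [hinit, weakDeriv_zero, weakDeriv_one] at h1
  have h2 : ∫ r in (0 : ℝ)..s, (b r * inner ℝ (jetProj 1 (u r)) (jetProj 0 v)
        + μ r * inner ℝ (jetProj 2 (u r)) (jetProj 2 v))
      = ∫ r in (0 : ℝ)..s, (b r * inner ℝ (weakDeriv (g r)) (jetProj 0 v)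
        + μ r * inner ℝ (weakDeriv (weakDeriv (g r))) (jetProj 2 v)) := by
    rw [intervalIntegral.integral_of_le hs.1, intervalIntegral.integral_of_le hs.1]
    refine integral_congr_ae ?_
    filter_upwards [ae_restrict_of_ae_restrict_of_subset (Ioc_subset_Ioc_right hs.2) hjet] with r hr
    rw [hr.2.1, hr.2.2]
  rw [h2]
  linarith

theorem isSolution_of_lift {T : ℝ} {b μ : ℝ → ℝ}
    (hb : MemLp b ⊤ (volume.restrict (Ioc 0 T))) (hμ : MemLp μ ⊤ (volume.restrict (Ioc 0 T)))
    {gin : L2Pos} {S : ℝ → L2Pos} (hS : IntegrableOn S (Ioc 0 T)) (hT : 0 ≤ T) {g : ℝ → L2Pos}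
    (hg : ContinuousOn g (Icc 0 T)) {u : ℝ → jets} (hu : MemLp u 2 (volume.restrict (Ioc 0 T)))
    (hug : ∀ᵐ s ∂(volume.restrict (Ioc 0 T)), jetProj 0 (u s) = g s)
    (heq : ∀ s ∈ Icc 0 T, adjoint (jetProj 0) (g s) = adjoint (jetProj 0) gin
        + ∫ r in (0 : ℝ)..s, (adjoint (jetProj 0) (S r) - coeffOp b μ r (u r))) :
    IsSolution T b μ gin S g := by
  have hν : volume.restrict (Ioo 0 T) = volume.restrict (Ioc 0 T) :=
    Measure.restrict_congr_set Ioo_ae_eq_Ioc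
  have hA : IntegrableOn (fun r => coeffOp b μ r (u r)) (Ioc 0 T) :=
    (memLp_coeffOp_apply hb hμ hu).integrable (by norm_num)
  have hV : ∀ᵐ s ∂(volume.restrict (Ioc 0 T)), MemV (g s) :=
    hug.mono fun s hs => hs ▸ memV_jetProj (u s)
  have h1 : ∀ᵐ s ∂(volume.restrict (Ioc 0 T)), jetProj 1 (u s) = weakDeriv (g s) :=
    hug.mono fun s hs => by rw [← hs, weakDeriv_zero]
  have h2 : ∀ᵐ s ∂(volume.restrict (Ioc 0 T)), jetProj 2 (u s) = weakDeriv (weakDeriv (g s)) :=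
    h1.mono fun s hs => by rw [← hs, weakDeriv_one]
  have h0 : g 0 = gin := by
    have := heq 0 ⟨le_rfl, hT⟩
    rw [intervalIntegral.integral_same, add_zero] at this
    exact injective_adjoint_jetProj_zero this
  refine ⟨hg, ?_, ?_, ?_, ?_, ?_, h0, ?_⟩
  · rw [hν]; exact hV.mono fun s hs => hs.1
  · rw [hν]; exact ((jetProj 0).comp_memLp' hu).ae_eq hug
  · rw [hν]; exact ((jetProj 1).comp_memLp' hu).ae_eq h1
  · rw [hν]; exact ((jetProj 2).comp_memLp' hu).ae_eq h2
  · rw [hν]; exact hV.mono fun s hs => hs.2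
  · intro v hv s hs
    obtain ⟨w, rfl, -, -⟩ := hv.exists_jet
    have e1 : inner ℝ _ w = inner ℝ _ w := congrArg (fun x => inner ℝ x w) (heq s hs)
    rw [inner_weak_form gin hS hA hs, adjoint_inner_left] at e1
    have e2 : ∫ r in (0 : ℝ)..s, (b r * inner ℝ (jetProj 1 (u r)) (jetProj 0 w)
          + μ r * inner ℝ (jetProj 2 (u r)) (jetProj 2 w))
        = ∫ r in (0 : ℝ)..s, (b r * inner ℝ (weakDeriv (g r)) (jetProj 0 w)
          + μ r * inner ℝ (weakDeriv (weakDeriv (g r))) (jetProj 2 w)) := by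
      rw [intervalIntegral.integral_of_le hs.1, intervalIntegral.integral_of_le hs.1]
      refine integral_congr_ae ?_
      filter_upwards [ae_restrict_of_ae_restrict_of_subset (Ioc_subset_Ioc_right hs.2) h1,
        ae_restrict_of_ae_restrict_of_subset (Ioc_subset_Ioc_right hs.2) h2] with r hr1 hr2
      rw [hr1, hr2]
    rw [e2] at e1
    rw [h0, weakDeriv_zero, weakDeriv_one]
    linarith

/-- The energy identity on `V`: continuity in time and the value of `‖g‖²`. -/
theorem exists_continuousOn_energy_jets {T : ℝ} (hT : 0 ≤ T) {b μ : ℝ → ℝ}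
    (hb : MemLp b ⊤ (volume.restrict (Ioc 0 T))) (hμ : MemLp μ ⊤ (volume.restrict (Ioc 0 T)))
    (gin : L2Pos) {S : ℝ → L2Pos} (hS : IntegrableOn S (Ioc 0 T)) {u : ℝ → jets}
    (hu : MemLp u 2 (volume.restrict (Ioc 0 T))) {C : ℝ}
    (hC : ∀ᵐ s ∂(volume.restrict (Ioc 0 T)), ‖jetProj 0 (u s)‖ ≤ C)
    (heq : ∀ᵐ s ∂(volume.restrict (Ioc 0 T)), adjoint (jetProj 0) (jetProj 0 (u s))
      = adjoint (jetProj 0) gin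
        + ∫ r in (0 : ℝ)..s, (adjoint (jetProj 0) (S r) - coeffOp b μ r (u r))) :
    ∃ g : ℝ → L2Pos, ContinuousOn g (Icc 0 T) ∧
      (∀ᵐ s ∂(volume.restrict (Ioc 0 T)), jetProj 0 (u s) = g s) ∧
      (∀ s ∈ Icc 0 T, adjoint (jetProj 0) (g s) = adjoint (jetProj 0) gin
        + ∫ r in (0 : ℝ)..s, (adjoint (jetProj 0) (S r) - coeffOp b μ r (u r))) ∧
      ∀ s ∈ Icc 0 T, ‖g s‖ ^ 2 + 2 * (∫ r in (0 : ℝ)..s, μ r * ‖jetProj 2 (u r)‖ ^ 2)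
        = ‖gin‖ ^ 2 + 2 * ∫ r in (0 : ℝ)..s, inner ℝ (S r) (g r) := by
  have hAu := memLp_coeffOp_apply hb hμ hu
  obtain ⟨g, hg, hgeq, hgE⟩ := exists_continuousOn_energy (jetProj 0) injective_jetProj_zero
    injective_adjoint_jetProj_zero hT gin hS hAu.neg hu hC
    (by simpa only [Pi.neg_apply, ← sub_eq_add_neg] using heq)
  simp only [Pi.neg_apply, ← sub_eq_add_neg, inner_neg_left, inner_coeffOp_self] at hgeq hgE
  have hug : ∀ᵐ s ∂(volume.restrict (Ioc 0 T)), jetProj 0 (u s) = g s := by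
    filter_upwards [heq, ae_restrict_mem measurableSet_Ioc] with s h1 h2
    exact injective_adjoint_jetProj_zero (h1.trans (hgeq s (Ioc_subset_Icc_self h2)).symm)
  refine ⟨g, hg, hug, hgeq, fun s hs => ?_⟩
  have hsub : Ioc 0 s ⊆ Ioc 0 T := Ioc_subset_Ioc_right hs.2
  have i1 : IntegrableOn (fun r => inner ℝ (S r) (jetProj 0 (u r))) (Ioc 0 T) := by
    refine Integrable.mono' (hS.norm.mul_const C)
      (hS.1.inner ((jetProj 0).continuous.comp_aestronglyMeasurable hu.1)) ?_
    filter_upwards [hC] with r hr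
    exact (norm_inner_le_norm _ _).trans (by gcongr)
  have i2 : IntegrableOn (fun r => μ r * ‖jetProj 2 (u r)‖ ^ 2) (Ioc 0 T) := by
    simpa only [IntegrableOn, inner_coeffOp_self] using integrable_inner_of_memLp_two hAu hu
  have e1 : ∫ r in (0 : ℝ)..s, inner ℝ (S r) (jetProj 0 (u r))
      = ∫ r in (0 : ℝ)..s, inner ℝ (S r) (g r) := by
    rw [intervalIntegral.integral_of_le hs.1, intervalIntegral.integral_of_le hs.1]
    refine integral_congr_ae ?_
    filter_upwards [ae_restrict_of_ae_restrict_of_subset hsub hug] with r hr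
    rw [hr]
  rw [hgE s hs, intervalIntegral.integral_sub (intervalIntegrable_of_mem_Icc i1 hs)
    (intervalIntegrable_of_mem_Icc i2 hs), e1]
  ring

/-- The difference solves the equation with zero data, so the energy identity makes a sum of
nonnegative terms equal to zero. Density of `V`, as injectivity of the adjoint, identifies the
difference with the function whose energy is computed. -/
theorem IsSolution.eqOn {T : ℝ} (hT : 0 ≤ T) {b μ : ℝ → ℝ}
    (hb : MemLp b ⊤ (volume.restrict (Ioc 0 T))) (hμ : MemLp μ ⊤ (volume.restrict (Ioc 0 T)))
    (hμ0 : ∀ᵐ s ∂(volume.restrict (Ioc 0 T)), 0 ≤ μ s)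
    {gin : L2Pos} {S : ℝ → L2Pos} (hS : IntegrableOn S (Ioc 0 T)) {g h : ℝ → L2Pos}
    (hg : IsSolution T b μ gin S g) (hh : IsSolution T b μ gin S h) : EqOn h g (Icc 0 T) := by
  obtain ⟨u, hu, hug, heu⟩ := hg.exists_lift hb hμ hS
  obtain ⟨v, hv, hvh, hev⟩ := hh.exists_lift hb hμ hS
  have hS' : IntegrableOn (fun r => adjoint (jetProj 0) (S r)) (Ioc 0 T) :=
    (adjoint (jetProj 0)).integrable_comp hS
  have hw : MemLp (v - u) 2 (volume.restrict (Ioc 0 T)) := hv.sub hu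
  have hAu : IntegrableOn (fun r => coeffOp b μ r (u r)) (Ioc 0 T) :=
    (memLp_coeffOp_apply hb hμ hu).integrable (by norm_num)
  have hAv : IntegrableOn (fun r => coeffOp b μ r (v r)) (Ioc 0 T) :=
    (memLp_coeffOp_apply hb hμ hv).integrable (by norm_num)
  have hdiff : ∀ s ∈ Icc 0 T, adjoint (jetProj 0) (h s - g s) = adjoint (jetProj 0) 0
      + ∫ r in (0 : ℝ)..s, (adjoint (jetProj 0) ((0 : ℝ → L2Pos) r)
        - coeffOp b μ r ((v - u) r)) := by
    intro s hs
    have hi : ∀ x : ℝ → jets, IntegrableOn (fun r => coeffOp b μ r (x r)) (Ioc 0 T) →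
        IntervalIntegrable (fun r => adjoint (jetProj 0) (S r) - coeffOp b μ r (x r)) volume 0 s :=
      fun x hx => intervalIntegrable_of_mem_Icc (hS'.sub hx) hs
    rw [map_sub, hev s hs, heu s hs, add_sub_add_left_eq_sub,
      ← intervalIntegral.integral_sub (hi v hAv) (hi u hAu), map_zero, zero_add]
    congr 1
    ext1 r
    simp only [Pi.zero_apply, Pi.sub_apply, map_sub, map_zero]
    abel
  have hae : ∀ᵐ s ∂(volume.restrict (Ioc 0 T)), jetProj 0 ((v - u) s) = h s - g s := by
    filter_upwards [hug, hvh] with s h1 h2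
    rw [Pi.sub_apply, map_sub, h1, h2]
  obtain ⟨C, hC⟩ := isCompact_Icc.exists_bound_of_continuousOn
    (hh.continuousOn.sub hg.continuousOn)
  obtain ⟨k, -, -, hkeq, hkE⟩ := exists_continuousOn_energy_jets hT hb hμ 0 (S := 0)
    integrableOn_zero hw (C := C)
    (by filter_upwards [hae, ae_restrict_mem measurableSet_Ioc] with s h1 h2
        rw [h1]; exact hC s (Ioc_subset_Icc_self h2))
    (by filter_upwards [hae, ae_restrict_mem measurableSet_Ioc] with s h1 h2
        rw [h1]; exact hdiff s (Ioc_subset_Icc_self h2))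
  intro s hs
  have hk : h s - g s = k s :=
    injective_adjoint_jetProj_zero ((hdiff s hs).trans (hkeq s hs).symm)
  have h1 := hkE s hs
  have h2 : 0 ≤ ∫ r in (0 : ℝ)..s, μ r * ‖jetProj 2 ((v - u) r)‖ ^ 2 := by
    rw [intervalIntegral.integral_of_le hs.1]
    refine integral_nonneg_of_ae ?_
    filter_upwards [ae_restrict_of_ae_restrict_of_subset (Ioc_subset_Ioc_right hs.2) hμ0] with r hr
    exact mul_nonneg hr (sq_nonneg _)
  simp only [Pi.zero_apply, inner_zero_left, intervalIntegral.integral_zero, norm_zero] at h1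
  have h3 : ‖k s‖ ^ 2 = 0 := le_antisymm (by linarith) (sq_nonneg _)
  rw [← sub_eq_zero, hk]
  simpa using h3

end BoundaryLayer

theorem mainTheorem2 (T : ℝ) (hT : 0 < T) (μ₀ : ℝ) (hμ₀ : 0 < μ₀) (b μ : ℝ → ℝ)
    (hb : MemLp b ⊤ (volume.restrict (Ioo 0 T)))
    (hμ : MemLp μ ⊤ (volume.restrict (Ioo 0 T)))
    (hμ_lower : ∀ᵐ s ∂(volume.restrict (Ioo 0 T)), μ₀ ≤ μ s)
    (gin : BoundaryLayer.L2Pos) (S : ℝ → BoundaryLayer.L2Pos)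
    (hS : Integrable S (volume.restrict (Ioo 0 T))) :
    ∃ g : ℝ → BoundaryLayer.L2Pos,
      BoundaryLayer.IsSolution T b μ gin S g ∧
      (∀ h : ℝ → BoundaryLayer.L2Pos,
        BoundaryLayer.IsSolution T b μ gin S h → EqOn h g (Icc 0 T)) ∧
      ∀ s ∈ Icc 0 T,
        1 / 2 * ‖g s‖ ^ 2 +
            (∫ r in (0 : ℝ)..s, μ r * ‖BoundaryLayer.weakDeriv (BoundaryLayer.weakDeriv (g r))‖ ^ 2)
          ≤ ‖gin‖ ^ 2 + (∫ r in (0 : ℝ)..s, ‖S r‖) ^ 2 := by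
  have hν : volume.restrict (Ioo 0 T) = volume.restrict (Ioc 0 T) :=
    Measure.restrict_congr_set Ioo_ae_eq_Ioc
  rw [hν] at hb hμ hμ_lower hS
  have hμ0 : ∀ᵐ s ∂(volume.restrict (Ioc 0 T)), 0 ≤ μ s :=
    hμ_lower.mono fun s hs => hμ₀.le.trans hs
  obtain ⟨M, hM0, hM⟩ := BoundaryLayer.exists_norm_formOp_le (BoundaryLayer.jetProj 0)
    (BoundaryLayer.jetProj 1) (BoundaryLayer.jetProj 2) hb hμ
  obtain ⟨u, C, hu, hC, heq⟩ := exists_weak_solution (BoundaryLayer.jetProj 0) hT.le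
    (A := BoundaryLayer.coeffOp b μ)
    (BoundaryLayer.aestronglyMeasurable_formOp _ _ _ hb hμ) hM0 hM
    (hμ0.mono fun r hr v => by
      rw [BoundaryLayer.inner_coeffOp_self]; exact mul_nonneg hr (sq_nonneg _))
    -- From `norm_sq_jet_le`: `μ₀ / 2 ‖v‖² ≤ μ₀ ‖∂²v‖² + μ₀ ‖v‖²`, where the left norm is that of
    -- `V` and the last is that of `L²`.
    (c := μ₀ / 2) (l := μ₀) (half_pos hμ₀) hμ₀.le
    (hμ_lower.mono fun r hr v => by
      rw [BoundaryLayer.inner_coeffOp_self]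
      have h1 := mul_le_mul_of_nonneg_left (BoundaryLayer.norm_sq_jet_le v) (half_pos hμ₀).le
      have h2 := mul_le_mul_of_nonneg_right hr (sq_nonneg ‖BoundaryLayer.jetProj 2 v‖)
      linarith) gin hS
  obtain ⟨g, hg, hug, hgeq, hgE⟩ :=
    BoundaryLayer.exists_continuousOn_energy_jets hT.le hb hμ gin hS hu hC heq
  have hsol := BoundaryLayer.isSolution_of_lift hb hμ hS hT.le hg hu hug hgeq
  refine ⟨g, hsol, fun h hh => hsol.eqOn hT.le hb hμ hμ0 hS hh, fun s hs => ?_⟩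
  have hdiss : ∀ s ∈ Icc 0 T, (∫ r in (0 : ℝ)..s,
        μ r * ‖BoundaryLayer.weakDeriv (BoundaryLayer.weakDeriv (g r))‖ ^ 2)
      = ∫ r in (0 : ℝ)..s, μ r * ‖BoundaryLayer.jetProj 2 (u r)‖ ^ 2 := by
    intro s hs
    rw [intervalIntegral.integral_of_le hs.1, intervalIntegral.integral_of_le hs.1]
    refine integral_congr_ae ?_
    filter_upwards [ae_restrict_of_ae_restrict_of_subset (Ioc_subset_Ioc_right hs.2) hug] with r hr
    rw [← hr, BoundaryLayer.weakDeriv_zero, BoundaryLayer.weakDeriv_one]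
  have hdiss0 : ∀ s ∈ Icc 0 T,
      0 ≤ ∫ r in (0 : ℝ)..s, μ r * ‖BoundaryLayer.jetProj 2 (u r)‖ ^ 2 := by
    intro s hs
    rw [intervalIntegral.integral_of_le hs.1]
    refine integral_nonneg_of_ae ?_
    filter_upwards [ae_restrict_of_ae_restrict_of_subset (Ioc_subset_Ioc_right hs.2) hμ0] with r hr
    exact mul_nonneg hr (sq_nonneg _)
  have hmul : ∀ f : ℝ → ℝ, ContinuousOn f (Icc 0 T) → ∀ s ∈ Icc 0 T,
      IntervalIntegrable (fun r => ‖S r‖ * f r) volume 0 s := fun f hf s hs => by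
    refine (intervalIntegrable_of_mem_Icc hS.norm hs).mul_continuousOn ?_
    rw [uIcc_of_le hs.1]
    exact hf.mono (Icc_subset_Icc_right hs.2)
  have hcross : ∀ f : ℝ → ℝ, ContinuousOn f (Icc 0 T) → (∀ s ∈ Icc 0 T, ‖g s‖ ≤ f s) →
      ∀ s ∈ Icc 0 T, ∫ r in (0 : ℝ)..s, inner ℝ (S r) (g r) ≤ ∫ r in (0 : ℝ)..s, ‖S r‖ * f r := by
    intro f hf hgf s hs
    refine intervalIntegral.integral_mono_on hs.1 ?_ (hmul f hf s hs) fun r hr => ?_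
    · have hsub : Icc 0 s ⊆ Icc 0 T := Icc_subset_Icc_right hs.2
      refine (hmul f hf s hs).mono_fun' ?_ ?_
      · rw [uIoc_of_le hs.1]
        exact (hS.1.mono_set (Ioc_subset_Ioc_right hs.2)).inner
          ((hg.mono (Ioc_subset_Icc_self.trans hsub)).aestronglyMeasurable measurableSet_Ioc)
      · rw [uIoc_of_le hs.1]
        filter_upwards [ae_restrict_mem measurableSet_Ioc] with r hr
        refine (norm_inner_le_norm _ _).trans ?_
        gcongr
        exact hgf r (hsub (Ioc_subset_Icc_self hr))
    · refine (real_inner_le_norm _ _).trans ?_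
      gcongr
      exact hgf r ⟨hr.1, hr.2.trans hs.2⟩
  have hgrow : ∀ s ∈ Icc 0 T, ‖g s‖ ≤ ‖gin‖ + ∫ r in (0 : ℝ)..s, ‖S r‖ := fun s hs =>
    le_add_integral_of_sq_le (norm_nonneg gin) hg.norm hS.norm (fun r => norm_nonneg _)
      (fun s hs => by
        have h1 := hgE s hs
        have h2 := hdiss0 s hs
        have h3 := hcross _ hg.norm (fun _ _ => le_rfl) s hs
        linarith) hs
  have h1 := hgE s hs
  have h2 := hcross _ (continuousOn_const.add (continuousOn_primitive_Icc hT.le hS.norm)) hgrow s hs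
  simp only [Pi.add_apply] at h2
  -- The scalar case evaluates `‖gin‖² + 2 ∫ ‖S‖ (‖gin‖ + ∫ ‖S‖)` as the square `(‖gin‖ + ∫ ‖S‖)²`;
  -- half of it is at most `‖gin‖² + (∫ ‖S‖)²`.
  have h3 := quadratic_primitive (ContinuousLinearMap.id ℝ ℝ) (fun _ _ => rfl) ‖gin‖ hs.1
    (IntegrableOn.mono_set hS.norm (Ioc_subset_Ioc_right hs.2))
  simp only [ContinuousLinearMap.id_apply, RCLike.inner_apply, conj_trivial,
    mul_comm _ ‖S _‖] at h3
  rw [hdiss s hs]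
  nlinarith [sq_nonneg (‖gin‖ - ∫ r in (0 : ℝ)..s, ‖S r‖)]
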